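/- Let $\bar A\in\{0,*\}^{n\times n}$ and $\bar b\in\{0,*\}^{n\times 1}$ be structured matrices (each entry is a fixed zero or an indeterminate $*$). A realization of a structured matrix $\bar M$ is a complex matrix that vanishes wherever $\bar M$ has a fixed zero; ${\bf S}_{\bar M}$ is the set of realizations. A pair $(A,b)$ is controllable if $[b,Ab,\dots,A^{n-1}b]$ has rank $n$, and $(\bar A,\bar b)$ is structurally controllable if some realization of it is controllable. Let $\bar F\in\{0,*\}^{n\times(n+1)}$ have exactly one $*$, at position $(i,j)$. *Graphs.* Let $\mathcal B$ be the bipartite graph with row vertices $x_1,\dots,x_n$, column vertices $v_1,\dots,v_{n+1}$, and an edge $(x_r,v_c)$ whenever $r=c$ or $[\bar A,\bar b]_{rc}=*$. A $\lambda$-edge is an edge $(x_r,v_r)$; it is a self-loop if in addition $\bar A_{rr}=*$. A matching is a set of edges no two of which share a vertex, a maximum matching is one with the largest number of edges, and ${\rm mt}(\cdot)$ is that number; the minimum weight maximum matching of a weighted bipartite graph is the least weight of its maximum matchings. Let $\mathcal G=\mathcal B-\{v_j\}$. *DM-decomposition.* Consider decompositions of the row and column vertices of a bipartite graph into pairwise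 disjoint sets $\mathcal V_k^+$, $\mathcal V_k^-$ ($k=0,1,\dots,d,\infty$), with induced subgraphs $\mathcal G_k$, such that: for $1\le k\le d$, $\mathcal V_k^+\neq\emptyset$ and ${\rm mt}(\mathcal G_k)=|\mathcal V_k^+|=|\mathcal V_k^-|$; ${\rm mt}(\mathcal G_0)=|\mathcal V_0^+|$, and $|\mathcal V_0^+|<|\mathcal V_0^-|$ if $\mathcal V_0^+\ne\emptyset$; ${\rm mt}(\mathcal G_\infty)=|\mathcal V_\infty^-|$, and $|\mathcal V_\infty^+|>|\mathcal V_\infty^-|$ if $\mathcal V_\infty^-\neq\emptyset$; every edge of each $\mathcal G_k$ lies in a maximum matching of $\mathcal G_k$; and there is an edge from $\mathcal V_k^+$ to $\mathcal V_l^-$ only if $k\le l$. A DM-decomposition is such a decomposition with the largest possible number $d$. Fix any DM-decomposition $(\mathcal V_k^+,\mathcal V_k^-)_k$ of $\mathcal G$, and let $i^*$ be the index with $x_i\in\mathcal V_{i^*}^+$. *The condition.* Let $\Omega_j$ be the set of $k$ with $1\le k\le d$ and $k\le i^*$ such that either $\mathcal G_k$ contains a self-loop, or the largest and the smallest number of $\lambda$-edges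 in a maximum matching of $\mathcal G_k$ differ. For $k\in\Omega_j$ let $\mathcal G_{ki^*}^{j_c}$ be the subgraph of $\mathcal G$ induced by the row vertices $(\mathcal V_k^+\cup\dots\cup\mathcal V_{i^*}^+)\setminus\{x_i\}$ and the column vertices $\mathcal V_k^-\cup\dots\cup\mathcal V_{i^*}^-$, with weight $1$ on the edges of $\mathcal G_k$ and weight $0$ on all other edges. **Proposition.** Suppose that $(\bar A,\bar b)$ is structurally controllable. Then for almost all controllable realizations $(A,b)$ of $(\bar A,\bar b)$ (that is, for all of them outside a set of Lebesgue measure zero in the space of the complex values of the $*$ entries of $[\bar A,\bar b]$), the following are equivalent: 1. there are $[\Delta A,\Delta b]\in{\bf S}_{\bar F}$, a nonzero $\lambda\in\mathbb C$ and a nonzero vector $q\in\mathbb C^n$ with $q^{\intercal}[A+\Delta A-\lambda I,\ b+\Delta b]=0$; 2. there is a $k\in\Omega_j$ for which the minimum weight maximum matching of $\mathcal G_{ki^*}^{j_c}$ is less than $|\mathcal V_k^+|$. -/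

import Mathlib

open MeasureTheory

noncomputable section

/-! ### Structured matrices, realizations, controllability -/

/-- A structured matrix: `true` is an indeterminate entry `*`, `false` a fixed zero. -/
abbrev StructuredMatrix (p q : Type) := Matrix p q Bool

/-- The realizations of a structured matrix: complex matrices vanishing at its fixed zeros. -/
def realizations {p q : Type} (M : StructuredMatrix p q) : Set (Matrix p q ℂ) :=
  {N | ∀ i k, M i k = false → N i k = 0}

/-- The parameter space of a structured matrix: one complex number for each entry `*`. -/
abbrev ParameterSpace {p q : Type} (M : StructuredMatrix p q) :=
  {e : p × q // M e.1 e.2 = true} → ℂ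

/-- The realization of `M` with the given parameter values. -/
def realizationOf {p q : Type} (M : StructuredMatrix p q) (θ : ParameterSpace M) :
    Matrix p q ℂ :=
  fun i k => if h : M i k = true then θ ⟨(i, k), h⟩ else 0

/-- The `n × (n+1)` matrix `[A, b]`; its last column is `b`. -/
def augment {n : ℕ} {R : Type} (A : Matrix (Fin n) (Fin n) R) (b : Fin n → R) :
    Matrix (Fin n) (Fin (n + 1)) R :=
  fun i => Fin.snoc (α := fun _ => R) (A i) (b i)

/-- The controllability matrix `[b, A b, …, A ^ (n-1) b]`. -/
def controllabilityMatrix {n : ℕ} (A : Matrix (Fin n) (Fin n) ℂ) (b : Fin n → ℂ) :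
    Matrix (Fin n) (Fin n) ℂ :=
  Matrix.of fun i k => ((A ^ (k : ℕ)).mulVec b) i

/-- `(A, b)` is controllable: its controllability matrix has full row rank. -/
def IsControllable {n : ℕ} (A : Matrix (Fin n) (Fin n) ℂ) (b : Fin n → ℂ) : Prop :=
  (controllabilityMatrix A b).rank = n

/-- Some realization of the structured pair is controllable. -/
def StructurallyControllable {n : ℕ} (A' : StructuredMatrix (Fin n) (Fin n))
    (b' : Fin n → Bool) : Prop :=
  ∃ (A : Matrix (Fin n) (Fin n) ℂ) (b : Fin n → ℂ),
    augment A b ∈ realizations (augment A' b') ∧ IsControllable A b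

/-- `P` holds for almost all controllable realizations of the structured pair: the parameter
values of those controllable realizations at which `P` fails form a Lebesgue null set in the
space of all parameter values. -/
def ForAlmostAllControllable {n : ℕ} (A' : StructuredMatrix (Fin n) (Fin n))
    (b' : Fin n → Bool)
    (P : Matrix (Fin n) (Fin n) ℂ → (Fin n → ℂ) → Prop) : Prop :=
  ∀ᵐ θ : ParameterSpace (augment A' b'),
    ∀ (A : Matrix (Fin n) (Fin n) ℂ) (b : Fin n → ℂ),
      augment A b = realizationOf (augment A' b') θ → IsControllable A b → P A b

/-- Some perturbation with structure `F` gives `(A, b)` a nonzero uncontrollable mode. -/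
def CanCreateNonzeroMode {n : ℕ} (F : StructuredMatrix (Fin n) (Fin (n + 1)))
    (A : Matrix (Fin n) (Fin n) ℂ) (b : Fin n → ℂ) : Prop :=
  ∃ (ΔA : Matrix (Fin n) (Fin n) ℂ) (Δb : Fin n → ℂ),
    augment ΔA Δb ∈ realizations F ∧
      ∃ (z : ℂ) (q : Fin n → ℂ), z ≠ 0 ∧ q ≠ 0 ∧
        Matrix.vecMul q
          (augment (A + ΔA - z • (1 : Matrix (Fin n) (Fin n) ℂ)) (b + Δb)) = 0

/-! ### Bipartite graphs and matchings -/

/-- A finite bipartite graph `(V⁺, V⁻, E)`. -/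
structure BipartiteGraph (V W : Type) where
  left : Finset V
  right : Finset W
  edges : Finset (V × W)
  edges_subset : edges ⊆ left ×ˢ right

namespace BipartiteGraph

variable {V W : Type} [DecidableEq V] [DecidableEq W]

/-- The subgraph induced by the vertices of `G` in `S` and `T`. -/
def induce (G : BipartiteGraph V W) (S : Finset V) (T : Finset W) : BipartiteGraph V W where
  left := G.left ∩ S
  right := G.right ∩ T
  edges := G.edges.filter fun e => e.1 ∈ S ∧ e.2 ∈ T
  edges_subset := by
    intro e he
    have h := Finset.mem_filter.mp he
    have h' := Finset.mem_product.mp (G.edges_subset h.1)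
    exact Finset.mem_product.mpr
      ⟨Finset.mem_inter.mpr ⟨h'.1, h.2.1⟩, Finset.mem_inter.mpr ⟨h'.2, h.2.2⟩⟩

/-- A matching: a set of edges no two of which share a vertex. -/
def IsMatching (G : BipartiteGraph V W) (M : Finset (V × W)) : Prop :=
  M ⊆ G.edges ∧ ∀ e ∈ M, ∀ f ∈ M, e.1 = f.1 ∨ e.2 = f.2 → e = f

/-- A matching with the largest number of edges. -/
def IsMaximumMatching (G : BipartiteGraph V W) (M : Finset (V × W)) : Prop :=
  G.IsMatching M ∧ ∀ N, G.IsMatching N → N.card ≤ M.card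

/-- A maximum matching exists, so the extrema below range over nonempty sets. -/
theorem exists_isMaximumMatching (G : BipartiteGraph V W) : ∃ M, G.IsMaximumMatching M := by
  classical
  have hne : (G.edges.powerset.filter fun M => G.IsMatching M).Nonempty :=
    ⟨∅, by simp [IsMatching]⟩
  obtain ⟨M, hM, hmax⟩ := Finset.exists_max_image _ Finset.card hne
  refine ⟨M, (Finset.mem_filter.mp hM).2, fun N hN => hmax N ?_⟩
  exact Finset.mem_filter.mpr ⟨Finset.mem_powerset.mpr hN.1, hN⟩

/-- `mt(G)`: the number of edges of a maximum matching. -/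
def mt (G : BipartiteGraph V W) : ℕ :=
  sSup {m | ∃ M, G.IsMatching M ∧ m = M.card}

/-- An edge is admissible if some maximum matching contains it. -/
def IsAdmissible (G : BipartiteGraph V W) (e : V × W) : Prop :=
  ∃ M, G.IsMaximumMatching M ∧ e ∈ M

/-- The minimum weight maximum matching: the least weight of a maximum matching. -/
def minWeightMaximumMatching (G : BipartiteGraph V W) (w : V × W → ℕ) : ℕ :=
  sInf {m | ∃ M, G.IsMaximumMatching M ∧ m = ∑ e ∈ M, w e}

/-! ### The Dulmage–Mendelsohn decomposition -/

/-- Decomposition of `G` into `d` consistent components (indices `1, …, d`), a horizontal tail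
(index `0`) and a vertical tail (the last index `d + 1`, standing for `∞`). The `k`-th component
is the subgraph induced by `Vp k` and `Vm k`. -/
structure IsBlockDecomposition (G : BipartiteGraph V W) (d : ℕ)
    (Vp : Fin (d + 2) → Finset V) (Vm : Fin (d + 2) → Finset W) : Prop where
  union_left : ∀ v, v ∈ G.left ↔ ∃ k, v ∈ Vp k
  union_right : ∀ w, w ∈ G.right ↔ ∃ k, w ∈ Vm k
  disjoint_left : ∀ k l, k ≠ l → Disjoint (Vp k) (Vp l)
  disjoint_right : ∀ k l, k ≠ l → Disjoint (Vm k) (Vm l)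
  consistent : ∀ k, k ≠ 0 → k ≠ Fin.last (d + 1) →
    (Vp k).Nonempty ∧ (G.induce (Vp k) (Vm k)).mt = (Vp k).card ∧
      (Vp k).card = (Vm k).card
  horizontal : (G.induce (Vp 0) (Vm 0)).mt = (Vp 0).card ∧
    ((Vp 0).Nonempty → (Vp 0).card < (Vm 0).card)
  vertical :
    (G.induce (Vp (Fin.last (d + 1))) (Vm (Fin.last (d + 1)))).mt =
        (Vm (Fin.last (d + 1))).card ∧
      ((Vm (Fin.last (d + 1))).Nonempty →
        (Vm (Fin.last (d + 1))).card < (Vp (Fin.last (d + 1))).card)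
  admissible : ∀ k, ∀ e ∈ (G.induce (Vp k) (Vm k)).edges,
    (G.induce (Vp k) (Vm k)).IsAdmissible e
  triangular : ∀ e ∈ G.edges, ∀ k l, e.1 ∈ Vp k → e.2 ∈ Vm l → k ≤ l

/-- A DM-decomposition: a block decomposition with the largest possible number of components. -/
def IsDMDecomposition (G : BipartiteGraph V W) (d : ℕ)
    (Vp : Fin (d + 2) → Finset V) (Vm : Fin (d + 2) → Finset W) : Prop :=
  G.IsBlockDecomposition d Vp Vm ∧
    ∀ (d' : ℕ) (Vp' : Fin (d' + 2) → Finset V) (Vm' : Fin (d' + 2) → Finset W),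
      G.IsBlockDecomposition d' Vp' Vm' → d' ≤ d

end BipartiteGraph

/-! ### The graphs attached to the pencil `[A - λ I, b]` -/

/-- `B(H_λ)` for `H_λ = [A - λ I, b]`: row vertices `x_i`, column vertices `v_k`, and an edge
`(x_i, v_k)` when `i = k` or the `(i, k)` entry of `[A, b]` is `*`. -/
def pencilGraph {n : ℕ} (H : StructuredMatrix (Fin n) (Fin (n + 1))) :
    BipartiteGraph (Fin n) (Fin (n + 1)) where
  left := Finset.univ
  right := Finset.univ
  edges := Finset.univ.filter fun e => e.2 = e.1.castSucc ∨ H e.1 e.2 = true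
  edges_subset := by intro e _; simp

/-- `B(H_λ)` without the column vertex `v_j`. -/
def pencilGraphDelete {n : ℕ} (H : StructuredMatrix (Fin n) (Fin (n + 1)))
    (j : Fin (n + 1)) : BipartiteGraph (Fin n) (Fin (n + 1)) :=
  (pencilGraph H).induce Finset.univ (Finset.univ.erase j)

/-- A `λ`-edge: an edge of the form `(x_i, v_i)`. -/
def IsLambdaEdge {n : ℕ} (e : Fin n × Fin (n + 1)) : Prop := e.2 = e.1.castSucc

instance {n : ℕ} : DecidablePred (IsLambdaEdge (n := n)) :=
  fun e => inferInstanceAs (Decidable (e.2 = e.1.castSucc))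

/-- A self-loop: a `λ`-edge at which `[A, b]` has an entry `*`. -/
def IsSelfLoop {n : ℕ} (H : StructuredMatrix (Fin n) (Fin (n + 1)))
    (e : Fin n × Fin (n + 1)) : Prop :=
  IsLambdaEdge e ∧ H e.1 e.2 = true

/-- The least number of `λ`-edges in a maximum matching of `G`. -/
def gammaMin {n : ℕ} (G : BipartiteGraph (Fin n) (Fin (n + 1))) : ℕ :=
  sInf {m | ∃ M, G.IsMaximumMatching M ∧ m = (M.filter IsLambdaEdge).card}

/-- The largest number of `λ`-edges in a maximum matching of `G`. -/
def gammaMax {n : ℕ} (G : BipartiteGraph (Fin n) (Fin (n + 1))) : ℕ :=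
  sSup {m | ∃ M, G.IsMaximumMatching M ∧ m = (M.filter IsLambdaEdge).card}

/-- `γ_nz(G) = 1`. -/
def GammaNonzero {n : ℕ} (H : StructuredMatrix (Fin n) (Fin (n + 1)))
    (G : BipartiteGraph (Fin n) (Fin (n + 1))) : Prop :=
  gammaMin G < gammaMax G ∨ ∃ e ∈ G.edges, IsSelfLoop H e

/-- `Ω_j`: the indices `k ≤ i*` of consistent components `G_k` of `B(H_λ) - v_j` with
`γ_nz(G_k) = 1`, for the decomposition `Vp`, `Vm` and `i* = s`. -/
def omegaSet {n d : ℕ} (H : StructuredMatrix (Fin n) (Fin (n + 1))) (j : Fin (n + 1))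
    (Vp : Fin (d + 2) → Finset (Fin n)) (Vm : Fin (d + 2) → Finset (Fin (n + 1)))
    (s : Fin (d + 2)) : Set (Fin (d + 2)) :=
  {k | k ≠ 0 ∧ k ≠ Fin.last (d + 1) ∧ k ≤ s ∧
    GammaNonzero H ((pencilGraphDelete H j).induce (Vp k) (Vm k))}

/-- The graph induced in `B(H_λ) - v_j` by the components `k, …, i* = s`, without the row
vertex `x_i`. -/
def intervalGraph {n d : ℕ} (H : StructuredMatrix (Fin n) (Fin (n + 1))) (j : Fin (n + 1))
    (Vp : Fin (d + 2) → Finset (Fin n)) (Vm : Fin (d + 2) → Finset (Fin (n + 1)))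
    (k s : Fin (d + 2)) (i : Fin n) : BipartiteGraph (Fin n) (Fin (n + 1)) :=
  (pencilGraphDelete H j).induce (((Finset.Icc k s).biUnion Vp).erase i)
    ((Finset.Icc k s).biUnion Vm)

/-- The weight that is `1` on the edges of the component induced by `Vp k` and `Vm k`, and `0`
on all other edges. -/
def componentWeight {n d : ℕ} (H : StructuredMatrix (Fin n) (Fin (n + 1))) (j : Fin (n + 1))
    (Vp : Fin (d + 2) → Finset (Fin n)) (Vm : Fin (d + 2) → Finset (Fin (n + 1)))
    (k : Fin (d + 2)) (e : Fin n × Fin (n + 1)) : ℕ :=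
  if e ∈ ((pencilGraphDelete H j).induce (Vp k) (Vm k)).edges then 1 else 0

end

/-! Structural controllability yields, for each column `v_j`, a matching `f` of all rows that misses
it: the λ-edges match every row with its own column and miss the input column, and the missed column
can be shifted along a path from the input to `v_j`. Through `f` the columns other than `v_j` are
indexed by the rows, so `[A - λI, b]` without column `j` becomes a square pencil `N(λ)`. Since the
graph has a perfect matching, a DM-decomposition has no tails, `f` matches every block with itself,
and `N` is block triangular. Maximality of `d` makes each block connected.

For a controllable pair the full pencil has no left null vector. Hence a change of the entry `(i,
j)` creates the mode `z` exactly when `N(z)` has a left null vector `q` with `q i ≠ 0`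
(`canCreateNonzeroMode_iff`). The weight condition for `k` says that all rows but `i` can be matched
with all columns but some `c` of block `k` (`minWeight_interval_lt_iff`), that is, that the minor of
`N` without row `i` and column `c` is not identically zero.

From modes to matchings: the left kernel of `N(z)` is the line through `q`, so the minor at `(i, c)`
is nonzero for every `c` in the support of a right null vector `u`. If `c` is taken from the last
block meeting this support, that diagonal block is singular at `z ≠ 0`. Generically this forces
`γ_nz = 1`, because otherwise the determinant of the block is a constant times a power of λ.

From matchings to modes: let `D` be the determinant of block `k`. Since `γ_nz = 1`, it has an
irreducible factor `p` of positive degree in λ that is not λ up to a unit. The crucial fact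
(`exists_parameter_mem_vars_of_dvd_det`) is that `p` involves a parameter from every column of the
block: `D` has degree at most one in each parameter, so two complementary factors share no
parameters and their terms combine freely, which by connectedness prevents them from dividing the
columns among themselves. The minor at `(i, c)` contains no parameter of column `c`, so `p` does not
divide it and their resultant is nonzero. Generically `p` thus has a nonzero root `z` at which the
minor does not vanish, and a row of the adjugate of `N(z)` is the required left null vector. -/

noncomputable section

/-! ### Generic parameter values -/

/-- A nonzero complex polynomial in finitely many variables is nonzero almost everywhere. -/
theorem ae_eval_ne_zero_fin : ∀ (n : ℕ) (p : MvPolynomial (Fin n) ℂ), p ≠ 0 →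
    ∀ᵐ θ : Fin n → ℂ, MvPolynomial.eval θ p ≠ 0 := by
  intro n
  induction n with
  | zero =>
    intro p hp
    refine Filter.Eventually.of_forall fun θ h => hp ?_
    rw [MvPolynomial.eq_C_of_isEmpty p] at h ⊢
    rw [MvPolynomial.eval_C] at h
    rw [h, map_zero]
  | succ n ih =>
    intro p hp
    have hmp := volume_preserving_piFinSuccAbove (fun _ : Fin (n + 1) => ℂ) 0
    have hprod : ∀ᵐ w : ℂ × (Fin n → ℂ), MvPolynomial.eval (Fin.cons w.1 w.2) p ≠ 0 := by
      have hcont : Continuous fun w : ℂ × (Fin n → ℂ) =>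
          MvPolynomial.eval (Fin.cons w.1 w.2 : Fin (n + 1) → ℂ) p := by
        have h1 : Continuous fun w : ℂ × (Fin n → ℂ) => (Fin.cons w.1 w.2 : Fin (n + 1) → ℂ) := by
          refine continuous_pi fun k => ?_
          refine Fin.cases ?_ (fun k => ?_) k
          · simpa using continuous_fst
          · simp only [Fin.cons_succ]
            exact (continuous_apply k).comp continuous_snd
        exact (MvPolynomial.continuous_eval p).comp h1
      have hmeas : MeasurableSet {w : ℂ × (Fin n → ℂ) |
          MvPolynomial.eval (Fin.cons w.1 w.2 : Fin (n + 1) → ℂ) p ≠ 0} :=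
        (isOpen_ne_fun hcont continuous_const).measurableSet
      -- Fubini with the order exchanged: the last `n` coordinates are fixed first, outside the
      -- zeros of the leading coefficient, and then only finitely many values of coordinate 0 are
      -- bad.
      rw [Measure.volume_eq_prod, Measure.ae_prod_iff_ae_ae hmeas,
        Measure.ae_ae_comm hmeas]
      set P := MvPolynomial.finSuccEquiv ℂ n p with hP
      have hP0 : P ≠ 0 := by simpa [hP] using hp
      filter_upwards [ih P.leadingCoeff (by simpa using hP0)] with s hs
      have hQ : P.map (MvPolynomial.eval s) ≠ 0 := by
        intro h
        apply hs
        have := congrArg (fun q => q.coeff P.natDegree) h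
        simpa [Polynomial.coeff_map] using this
      have hfin : {y : ℂ | (P.map (MvPolynomial.eval s)).IsRoot y}.Finite :=
        Polynomial.finite_setOfPred_isRoot hQ
      have := hfin.measure_zero (volume : Measure ℂ)
      rw [measure_eq_zero_iff_ae_notMem] at this
      filter_upwards [this] with y hy h
      apply hy
      rw [MvPolynomial.eval_eq_eval_mv_eval'] at h
      exact h
    have := hmp.quasiMeasurePreserving.ae hprod
    filter_upwards [this] with θ hθ
    have e : (Fin.cons ((MeasurableEquiv.piFinSuccAbove (fun _ : Fin (n + 1) => ℂ) 0) θ).1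
        ((MeasurableEquiv.piFinSuccAbove (fun _ : Fin (n + 1) => ℂ) 0) θ).2
          : Fin (n + 1) → ℂ) = θ := by
      funext k
      refine Fin.cases ?_ (fun k => ?_) k
      · rfl
      · rfl
    rwa [e] at hθ

theorem ae_eval_ne_zero {σ : Type} [Fintype σ] (p : MvPolynomial σ ℂ) (hp : p ≠ 0) :
    ∀ᵐ θ : σ → ℂ, MvPolynomial.eval θ p ≠ 0 := by
  let e : Fin (Fintype.card σ) ≃ σ := (Fintype.equivFin σ).symm
  have hmp := (volume_measurePreserving_piCongrLeft (fun _ : σ => ℂ) e).symm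
  have h := ae_eval_ne_zero_fin _ (MvPolynomial.rename e.symm p)
    (fun h => hp (MvPolynomial.rename_injective _ e.symm.injective (by simpa using h)))
  filter_upwards [hmp.quasiMeasurePreserving.ae h] with θ hθ
  rw [MvPolynomial.eval_rename] at hθ
  convert hθ using 3
  funext t
  simp only [Function.comp]
  change θ t = θ (e (e.symm t))
  simp

/-- An irreducible polynomial of positive degree over a factorial ring has nonzero resultant with
each polynomial that it does not divide. -/
theorem resultant_ne_zero_of_irreducible {R K : Type} [CommRing R] [IsDomain R]
    [UniqueFactorizationMonoid R] [Field K] [Algebra R K] [IsFractionRing R K]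
    (p a : Polynomial R) (hp : Irreducible p) (hd : p.natDegree ≠ 0) (ha : ¬ p ∣ a) :
    p.resultant a ≠ 0 := by
  classical
  let _ : StrongNormalizationMonoid R :=
    UniqueFactorizationMonoid.strongNormalizationMonoid
  let _ : NormalizedGCDMonoid R := UniqueFactorizationMonoid.toNormalizedGCDMonoid R
  have hprim : p.IsPrimitive := hp.isPrimitive hd
  have hinj : Function.Injective (algebraMap R K) := IsFractionRing.injective _ _
  have hirr : Irreducible (p.map (algebraMap R K)) :=
    (hprim.irreducible_iff_irreducible_map_fraction_map (K := K)).1 hp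
  intro h
  have h1 : (p.map (algebraMap R K)).resultant (a.map (algebraMap R K)) = 0 := by
    rw [Polynomial.natDegree_map_eq_of_injective hinj,
      Polynomial.natDegree_map_eq_of_injective hinj, Polynomial.resultant_map_map, h, map_zero]
  rw [Polynomial.resultant_eq_zero_iff] at h1
  apply h1.2
  rw [hirr.coprime_iff_not_dvd]
  rintro ⟨b, hb⟩
  -- Clearing denominators turns divisibility over the fraction field into `p ∣ C s * a`; the prime
  -- `p` has positive degree and cannot divide the constant.
  obtain ⟨s, hs0, hs⟩ := IsLocalization.integerNormalization_spec (nonZeroDivisors R) b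
  have hdvd : p ∣ Polynomial.C s * a := by
    refine ⟨IsLocalization.integerNormalization (nonZeroDivisors R) b, ?_⟩
    apply Polynomial.map_injective _ hinj
    rw [Polynomial.map_mul, Polynomial.map_mul, hb]
    rw [hs, Polynomial.map_C, Algebra.smul_def, Polynomial.algebraMap_apply]
    ring
  rcases hp.prime.dvd_or_dvd hdvd with h2 | h2
  · have := Polynomial.natDegree_le_of_dvd h2 (by simpa using nonZeroDivisors.ne_zero hs0)
    rw [Polynomial.natDegree_C] at this
    omega
  · exact ha h2

/-- An irreducible polynomial over a polynomial ring that has positive degree, is not divisible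
by the variable and does not divide `a` generically has a nonzero root which is no root of `a`. -/
theorem exists_generic_root {σ : Type} (p a : Polynomial (MvPolynomial σ ℂ))
    (hp : Irreducible p) (hd : p.natDegree ≠ 0) (hX : ¬ Polynomial.X ∣ p) (ha : ¬ p ∣ a) :
    ∃ r : MvPolynomial σ ℂ, r ≠ 0 ∧ ∀ θ : σ → ℂ, MvPolynomial.eval θ r ≠ 0 →
      ∃ z : ℂ, z ≠ 0 ∧ (p.map (MvPolynomial.eval θ)).eval z = 0 ∧
        (a.map (MvPolynomial.eval θ)).eval z ≠ 0 := by
  have hres : p.resultant a ≠ 0 :=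
    resultant_ne_zero_of_irreducible (K := FractionRing (MvPolynomial σ ℂ)) p a hp hd ha
  -- The constant coefficient keeps 0 from being a root, the leading coefficient preserves the
  -- degree and so the existence of a root, and the resultant excludes a common root with `a`.
  refine ⟨p.coeff 0 * p.leadingCoeff * p.resultant a, ?_, fun θ hθ => ?_⟩
  · refine mul_ne_zero (mul_ne_zero ?_ ?_) hres
    · rwa [Ne, ← Polynomial.X_dvd_iff]
    · simpa using hp.ne_zero
  · rw [map_mul, map_mul] at hθ
    have h0 := left_ne_zero_of_mul (left_ne_zero_of_mul hθ)
    have h1 := right_ne_zero_of_mul (left_ne_zero_of_mul hθ)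
    have h2 := right_ne_zero_of_mul hθ
    have hdeg : (p.map (MvPolynomial.eval θ)).natDegree = p.natDegree :=
      Polynomial.natDegree_map_of_leadingCoeff_ne_zero _ h1
    obtain ⟨z, hz⟩ := IsAlgClosed.exists_root (p.map (MvPolynomial.eval θ)) (by
      intro h
      exact hd (by rw [← hdeg]; exact Polynomial.natDegree_eq_of_degree_eq_some h))
    refine ⟨z, ?_, hz, ?_⟩
    · rintro rfl
      apply h0
      rw [← Polynomial.coeff_map, Polynomial.coeff_zero_eq_eval_zero]
      exact hz
    · intro haz
      obtain ⟨u, v, -, -, huv⟩ := Polynomial.exists_mul_add_mul_eq_C_resultant p a le_rfl le_rfl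
        (Or.inl hd)
      apply h2
      have := congrArg (fun q => (q.map (MvPolynomial.eval θ)).eval z) huv
      simp only [Polynomial.map_add, Polynomial.map_mul, Polynomial.eval_add, Polynomial.eval_mul,
        Polynomial.map_C, Polynomial.eval_C] at this
      rw [← this, show Polynomial.eval z (Polynomial.map (MvPolynomial.eval θ) p) = 0 from hz, haz]
      ring

/-! ### Determinants of matrices with independent parameters -/

section Pattern

variable {ι σ A : Type} [CommRing A]

/-- The matrix whose `(r, s)` entry is the variable `e r s`, if there is one, plus the
constant `l r s`. -/
def patternMatrix (e : ι → ι → Option σ) (l : ι → ι → A) : Matrix ι ι (MvPolynomial σ A) :=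
  fun r s => (e r s).elim 0 MvPolynomial.X + MvPolynomial.C (l r s)

/-- The permutation `π` together with the set `T` of rows from which the variable is chosen gives
a nonzero term in the expansion of the determinant. -/
def IsTerm (e : ι → ι → Option σ) (l : ι → ι → A) (π : Equiv.Perm ι) (T : Finset ι) : Prop :=
  (∀ r ∈ T, ∃ t, e r (π r) = some t) ∧ ∀ r ∉ T, l r (π r) ≠ 0

/-- The exponent of the term given by `π` and `T`. -/
def termExponent (e : ι → ι → Option σ) (π : Equiv.Perm ι) (T : Finset ι) : σ →₀ ℕ :=
  ∑ r ∈ T, (e r (π r)).elim 0 fun t => Finsupp.single t 1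

/-- No variable occurs at two positions. -/
def IndependentEntries (e : ι → ι → Option σ) : Prop :=
  ∀ r s r' s' t, e r s = some t → e r' s' = some t → r = r' ∧ s = s'

/-- Each row has at most one nonzero entry. -/
def RowFunctional (l : ι → ι → A) : Prop := ∀ r s s', l r s ≠ 0 → l r s' ≠ 0 → s = s'

theorem exists_of_termExponent_ne_zero {e : ι → ι → Option σ} {π : Equiv.Perm ι} {T : Finset ι}
    {t : σ} (h : termExponent e π T t ≠ 0) : ∃ r ∈ T, e r (π r) = some t := by
  rw [termExponent, Finsupp.finsetSum_apply] at h
  obtain ⟨r, hr, h⟩ := Finset.exists_ne_zero_of_sum_ne_zero h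
  refine ⟨r, hr, ?_⟩
  rcases hx : e r (π r) with _ | t'
  · simp [hx] at h
  · classical
    simp only [hx, Option.elim, Finsupp.single_apply] at h
    split_ifs at h with h'
    · rw [h']
    · exact absurd rfl h

variable [DecidableEq ι]

/-- A variable sits at one position only, so its exponent records whether the term uses that
position. -/
theorem termExponent_apply {e : ι → ι → Option σ} (he : IndependentEntries e)
    {π : Equiv.Perm ι} {T : Finset ι} {r s : ι} {t : σ} (h : e r s = some t) :
    termExponent e π T t = if r ∈ T ∧ π r = s then 1 else 0 := by
  classical
  split_ifs with hr
  · rw [termExponent, Finsupp.finsetSum_apply, Finset.sum_eq_single r]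
    · simp [hr.2, h]
    · intro r' _ hr'
      rcases hx : e r' (π r') with _ | t'
      · simp
      · simp only [Option.elim, Finsupp.single_apply]
        rw [if_neg]
        rintro rfl
        exact hr' (he _ _ _ _ _ hx h).1
    · exact fun h' => absurd hr.1 h'
  · by_contra h0
    obtain ⟨r', hr', hx⟩ := exists_of_termExponent_ne_zero h0
    obtain ⟨rfl, rfl⟩ := he _ _ _ _ _ hx h
    exact hr ⟨hr', rfl⟩

/-- The exponent determines `T` and the values of `π` on `T`. In the remaining rows `π` must pick a
nonzero constant entry, and each row has at most one. -/
theorem IsTerm.eq_of_termExponent_eq {e : ι → ι → Option σ} {l : ι → ι → A}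
    (he : IndependentEntries e) (hl : RowFunctional l) {π π' : Equiv.Perm ι} {T T' : Finset ι}
    (h : IsTerm e l π T) (h' : IsTerm e l π' T')
    (hm : termExponent e π T = termExponent e π' T') : π = π' ∧ T = T' := by
  have key : ∀ {π π' : Equiv.Perm ι} {T T' : Finset ι}, IsTerm e l π T →
      termExponent e π T = termExponent e π' T' → ∀ r ∈ T, r ∈ T' ∧ π' r = π r := by
    intro π π' T T' h hm r hr
    obtain ⟨t, ht⟩ := h.1 r hr
    have h1 := termExponent_apply he (π := π) (T := T) ht
    have h2 := termExponent_apply he (π := π') (T := T') ht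
    rw [if_pos ⟨hr, rfl⟩, hm, h2] at h1
    by_contra h3
    rw [if_neg h3] at h1
    exact absurd h1 (by norm_num)
  have hT : T = T' := Finset.Subset.antisymm (fun r hr => (key h hm r hr).1)
    fun r hr => (key h' hm.symm r hr).1
  refine ⟨Equiv.ext fun r => ?_, hT⟩
  by_cases hr : r ∈ T
  · exact (key h hm r hr).2.symm
  · exact hl r _ _ (h.2 r hr) (h'.2 r (hT ▸ hr))

variable [Fintype ι]

theorem prod_eq_monomial_of_isTerm {e : ι → ι → Option σ} {l : ι → ι → A} {π : Equiv.Perm ι}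
    {T : Finset ι} (h : IsTerm e l π T) :
    (∏ r ∈ T, (e r (π r)).elim 0 MvPolynomial.X) * (∏ r ∈ Finset.univ \ T, MvPolynomial.C (l r (π r)))
      = MvPolynomial.monomial (termExponent e π T) (∏ r ∈ Finset.univ \ T, l r (π r)) := by
  have : (∏ r ∈ T, (e r (π r)).elim 0 MvPolynomial.X : MvPolynomial σ A)
      = MvPolynomial.monomial (termExponent e π T) 1 := by
    rw [termExponent, MvPolynomial.monomial_sum_one]
    refine Finset.prod_congr rfl fun r hr => ?_
    obtain ⟨t, ht⟩ := h.1 r hr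
    rw [ht]
    rfl
  rw [this, ← map_prod, mul_comm, MvPolynomial.C_mul_monomial, mul_one]

theorem prod_eq_zero_of_not_isTerm {e : ι → ι → Option σ} {l : ι → ι → A} {π : Equiv.Perm ι}
    {T : Finset ι} (h : ¬ IsTerm e l π T) :
    (∏ r ∈ T, (e r (π r)).elim 0 MvPolynomial.X) *
      (∏ r ∈ Finset.univ \ T, MvPolynomial.C (σ := σ) (l r (π r))) = 0 := by
  rw [IsTerm, not_and_or] at h
  push Not at h
  rcases h with ⟨r, hr, h⟩ | ⟨r, hr, h⟩
  · rw [Finset.prod_eq_zero hr, zero_mul]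
    rcases hx : e r (π r) with _ | t
    · rfl
    · exact absurd hx (h t)
  · rw [mul_comm, Finset.prod_eq_zero (i := r) (by simpa using hr), zero_mul]
    rw [h, map_zero]

theorem det_patternMatrix (e : ι → ι → Option σ) (l : ι → ι → A) :
    (patternMatrix e l).det = ∑ x : Equiv.Perm ι × Finset ι,
      ((Equiv.Perm.sign x.1 : ℤ) : MvPolynomial σ A) *
        ((∏ r ∈ x.2, (e r (x.1 r)).elim 0 MvPolynomial.X) *
          (∏ r ∈ Finset.univ \ x.2, MvPolynomial.C (l r (x.1 r)))) := by
  rw [← Matrix.det_transpose, Matrix.det_apply', Fintype.sum_prod_type]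
  refine Finset.sum_congr rfl fun π _ => ?_
  dsimp only
  rw [← Finset.mul_sum]
  congr 1
  have : ∀ r, (patternMatrix e l).transpose (π r) r
      = (e r (π r)).elim 0 MvPolynomial.X + MvPolynomial.C (l r (π r)) := fun r => rfl
  rw [Finset.prod_congr rfl fun r _ => this r, Finset.prod_add, Finset.powerset_univ]

/-- Distinct terms have distinct exponents, so nothing cancels in the expansion and each coefficient
comes from a single term. -/
theorem coeff_det_patternMatrix {e : ι → ι → Option σ} {l : ι → ι → A}
    (he : IndependentEntries e) (hl : RowFunctional l) {π : Equiv.Perm ι} {T : Finset ι}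
    (h : IsTerm e l π T) :
    (patternMatrix e l).det.coeff (termExponent e π T)
      = (Equiv.Perm.sign π : ℤ) * ∏ r ∈ Finset.univ \ T, l r (π r) := by
  classical
  rw [det_patternMatrix, MvPolynomial.coeff_sum, Finset.sum_eq_single (π, T)]
  · rw [prod_eq_monomial_of_isTerm h]
    have : (((Equiv.Perm.sign π : ℤ) : MvPolynomial σ A)) = MvPolynomial.C ((Equiv.Perm.sign π : ℤ) : A) := by
      rw [map_intCast]
    rw [this, MvPolynomial.C_mul_monomial, MvPolynomial.coeff_monomial, if_pos rfl]
  · rintro ⟨π', T'⟩ - hne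
    by_cases h' : IsTerm e l π' T'
    · rw [prod_eq_monomial_of_isTerm h']
      have : (((Equiv.Perm.sign π' : ℤ) : MvPolynomial σ A)) = MvPolynomial.C ((Equiv.Perm.sign π' : ℤ) : A) := by
        rw [map_intCast]
      rw [this, MvPolynomial.C_mul_monomial, MvPolynomial.coeff_monomial, if_neg]
      intro hm
      obtain ⟨rfl, rfl⟩ := h'.eq_of_termExponent_eq he hl h hm
      exact hne rfl
    · rw [prod_eq_zero_of_not_isTerm h', mul_zero, MvPolynomial.coeff_zero]
  · simp

theorem exists_isTerm_of_coeff_det_ne_zero {e : ι → ι → Option σ} {l : ι → ι → A} {m : σ →₀ ℕ}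
    (hm : (patternMatrix e l).det.coeff m ≠ 0) :
    ∃ π T, IsTerm e l π T ∧ m = termExponent e π T := by
  classical
  rw [det_patternMatrix, MvPolynomial.coeff_sum] at hm
  obtain ⟨⟨π, T⟩, -, h⟩ := Finset.exists_ne_zero_of_sum_ne_zero hm
  by_cases h' : IsTerm e l π T
  · refine ⟨π, T, h', ?_⟩
    rw [prod_eq_monomial_of_isTerm h', ← map_intCast (MvPolynomial.C (σ := σ) (R := A)),
      MvPolynomial.C_mul_monomial, MvPolynomial.coeff_monomial] at h
    split_ifs at h with h2
    · exact h2.symm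
    · exact absurd rfl h
  · rw [prod_eq_zero_of_not_isTerm h', mul_zero, MvPolynomial.coeff_zero] at h
    exact absurd rfl h

theorem coeff_det_patternMatrix_ne_zero [IsDomain A] {e : ι → ι → Option σ} {l : ι → ι → A}
    (he : IndependentEntries e) (hl : RowFunctional l) {π : Equiv.Perm ι} {T : Finset ι}
    (h : IsTerm e l π T) : (patternMatrix e l).det.coeff (termExponent e π T) ≠ 0 := by
  rw [coeff_det_patternMatrix he hl h]
  refine mul_ne_zero ?_ (Finset.prod_ne_zero_iff.2 fun r hr => h.2 r (by simpa using hr))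
  rcases Int.units_eq_one_or (Equiv.Perm.sign π) with h1 | h1 <;> simp [h1]

theorem apply_eq_zero_of_notMem_vars {P : MvPolynomial σ A} {α : σ →₀ ℕ} {t : σ}
    (hα : P.coeff α ≠ 0) (ht : t ∉ P.vars) : α t = 0 := by
  by_contra h
  exact ht ((MvPolynomial.mem_vars_iff_mem_support t).2
    ⟨α, MvPolynomial.mem_support_iff.2 hα, Finsupp.mem_support_iff.2 h⟩)

/-- The exponents of two terms of a product whose factors have no common variable can be
exchanged. -/
theorem exists_exchange_coeff_ne_zero [IsDomain A] {P Q : MvPolynomial σ A}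
    (hPQ : ∀ t, t ∈ P.vars → t ∉ Q.vars) {m₁ m₂ : σ →₀ ℕ} (h₁ : (P * Q).coeff m₁ ≠ 0)
    (h₂ : (P * Q).coeff m₂ ≠ 0) :
    ∃ m, (P * Q).coeff m ≠ 0 ∧ (∀ t ∈ P.vars, m t = m₁ t) ∧ ∀ t ∈ Q.vars, m t = m₂ t := by
  classical
  have hP : ∀ {α : σ →₀ ℕ} {t}, P.coeff α ≠ 0 → t ∉ P.vars → α t = 0 :=
    fun hα ht => apply_eq_zero_of_notMem_vars hα ht
  have hQ : ∀ {α : σ →₀ ℕ} {t}, Q.coeff α ≠ 0 → t ∉ Q.vars → α t = 0 :=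
    fun hα ht => apply_eq_zero_of_notMem_vars hα ht
  have split : ∀ {m : σ →₀ ℕ}, (P * Q).coeff m ≠ 0 →
      ∃ α β, P.coeff α ≠ 0 ∧ Q.coeff β ≠ 0 ∧ m = α + β := by
    intro m hm
    rw [MvPolynomial.coeff_mul] at hm
    obtain ⟨⟨α, β⟩, hx, h⟩ := Finset.exists_ne_zero_of_sum_ne_zero hm
    exact ⟨α, β, left_ne_zero_of_mul h, right_ne_zero_of_mul h,
      (Finset.HasAntidiagonal.mem_antidiagonal.1 hx).symm⟩
  obtain ⟨α₁, β₁, ha₁, hb₁, rfl⟩ := split h₁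
  obtain ⟨α₂, β₂, ha₂, hb₂, rfl⟩ := split h₂
  refine ⟨α₁ + β₂, ?_, fun t ht => ?_, fun t ht => ?_⟩
  -- As the factors have no common variable, the exponent splits in only one way, and no
  -- cancellation is possible.
  · rw [MvPolynomial.coeff_mul, Finset.sum_eq_single (α₁, β₂)]
    · exact mul_ne_zero ha₁ hb₂
    · rintro ⟨α, β⟩ hx hne
      by_contra h
      have ha := left_ne_zero_of_mul h
      have hb := right_ne_zero_of_mul h
      have hx := Finset.HasAntidiagonal.mem_antidiagonal.1 hx
      have hα : α = α₁ := by
        ext t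
        have := DFunLike.congr_fun hx t
        simp only [Finsupp.add_apply] at this
        by_cases ht : t ∈ P.vars
        · rw [hQ hb (hPQ t ht), hQ hb₂ (hPQ t ht)] at this
          simpa using this
        · rw [hP ha ht, hP ha₁ ht]
      apply hne
      subst hα
      simpa using hx
    · intro h
      simp at h
  · simp [hQ hb₂ (hPQ t ht), hQ hb₁ (hPQ t ht)]
  · have hP' : t ∉ P.vars := fun h => hPQ t h ht
    simp [hP ha₁ hP', hP ha₂ hP']

end Pattern

/-! ### Factors of the determinant of an irreducible pencil -/

/-- Regard a polynomial in `λ` over a polynomial ring as a polynomial in the parameters over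
`ℂ[λ]`. -/
def swapVariables (σ : Type) :
    Polynomial (MvPolynomial σ ℂ) →+* MvPolynomial σ (Polynomial ℂ) :=
  Polynomial.eval₂RingHom (MvPolynomial.map Polynomial.C) (MvPolynomial.C Polynomial.X)

/-- Both views are needed: roots and resultants concern polynomials in λ over the parameters, while
the terms of the determinant are told apart by their monomials in the parameters over `ℂ[λ]`. -/
theorem coeff_swapVariables {σ : Type} (p : Polynomial (MvPolynomial σ ℂ)) (m : σ →₀ ℕ) (g : ℕ) :
    ((swapVariables σ p).coeff m).coeff g = (p.coeff g).coeff m := by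
  induction p using Polynomial.induction_on' with
  | add p q hp hq => simp [hp, hq]
  | monomial k a =>
    simp only [swapVariables, Polynomial.coe_eval₂RingHom, Polynomial.eval₂_monomial]
    rw [← map_pow, mul_comm, MvPolynomial.coeff_C_mul, MvPolynomial.coeff_map,
      Polynomial.coeff_monomial, mul_comm, Polynomial.coeff_C_mul_X_pow]
    by_cases h : g = k
    · simp [h]
    · rw [if_neg h, if_neg (Ne.symm h), MvPolynomial.coeff_zero]

theorem swapVariables_injective (σ : Type) : Function.Injective (swapVariables σ) := by
  intro p q h
  ext g m
  rw [← coeff_swapVariables, h, coeff_swapVariables]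

theorem swapVariables_map_C {σ : Type} (p : Polynomial ℂ) :
    swapVariables σ (p.map MvPolynomial.C) = MvPolynomial.C p := by
  classical
  ext m g
  rw [coeff_swapVariables, Polynomial.coeff_map, MvPolynomial.coeff_C, MvPolynomial.coeff_C]
  split_ifs <;> simp

section Pencil

variable {ι σ : Type}

/-- The matrix over `ℂ[parameters][λ]` with a parameter at the position `(r, s)` if `e r s` is one
and with the additional entry `l r s`. -/
def parametricPencil (e : ι → ι → Option σ) (l : ι → ι → Polynomial ℂ) :
    Matrix ι ι (Polynomial (MvPolynomial σ ℂ)) :=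
  fun r s => Polynomial.C ((e r s).elim 0 MvPolynomial.X) + (l r s).map MvPolynomial.C

/-- The entries `-λ` at the positions given by `L`. -/
def lambdaEntries (L : ι → ι → Prop) [∀ r s, Decidable (L r s)] (r s : ι) : Polynomial ℂ :=
  if L r s then -Polynomial.X else 0

theorem lambdaEntries_ne_zero {L : ι → ι → Prop} [∀ r s, Decidable (L r s)] {r s : ι} :
    lambdaEntries L r s ≠ 0 ↔ L r s := by
  unfold lambdaEntries
  split_ifs with h <;> simp [h]

variable {e : ι → ι → Option σ} {L : ι → ι → Prop} [∀ r s, Decidable (L r s)]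

/-- There is a parameter or a `λ` at the position `(r, s)`. -/
def IsEntry (e : ι → ι → Option σ) (L : ι → ι → Prop) (r s : ι) : Prop :=
  (∃ t, e r s = some t) ∨ L r s

variable [Fintype ι]

/-- A position may carry both a parameter and a λ. Here the parameter is preferred, so that every
parameter on `π` occurs in the term. -/
theorem isTerm_parameters {π : Equiv.Perm ι} (h : ∀ r, IsEntry e L r (π r)) :
    ∃ T, IsTerm e (lambdaEntries L) π T ∧ ∀ r t, e r (π r) = some t → r ∈ T := by
  classical
  refine ⟨Finset.univ.filter fun r => ∃ t, e r (π r) = some t, ⟨fun r hr => by simpa using hr,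
    fun r hr => ?_⟩, fun r t ht => by simp [ht]⟩
  rw [lambdaEntries_ne_zero]
  exact (h r).resolve_left (by simpa using hr)

/-- The opposite choice: λ is preferred, so the degree of the term in λ is the number of λ-positions
on `π`. -/
theorem isTerm_lambdas {π : Equiv.Perm ι} (h : ∀ r, IsEntry e L r (π r)) :
    ∃ T, IsTerm e (lambdaEntries L) π T ∧ ∀ r, r ∈ T ↔ ¬ L r (π r) := by
  refine ⟨Finset.univ.filter fun r => ¬ L r (π r), ⟨fun r hr => ?_, fun r hr => ?_⟩,
    fun r => by simp⟩
  · exact (h r).resolve_right (by simpa using hr)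
  · rw [lambdaEntries_ne_zero]
    simpa using hr

variable [DecidableEq ι]

theorem swapVariables_det (e : ι → ι → Option σ) (l : ι → ι → Polynomial ℂ) :
    swapVariables σ (parametricPencil e l).det = (patternMatrix e l).det := by
  rw [RingHom.map_det]
  congr 1
  ext1 r s
  simp only [RingHom.mapMatrix_apply, Matrix.map_apply, parametricPencil, patternMatrix, map_add,
    swapVariables_map_C]
  congr 1
  cases e r s <;> simp [swapVariables]

theorem eval_det_parametricPencil (e : ι → ι → Option σ) (l : ι → ι → Polynomial ℂ)
    (θ : σ → ℂ) (z : ℂ) :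
    ((parametricPencil e l).det.map (MvPolynomial.eval θ)).eval z
      = (Matrix.of fun r s => (e r s).elim 0 θ + (l r s).eval z).det := by
  rw [← Polynomial.coe_evalRingHom, ← Polynomial.coe_mapRingHom, RingHom.map_det, RingHom.map_det]
  congr 1
  ext r s
  simp only [RingHom.mapMatrix_apply, Matrix.map_apply, parametricPencil, Matrix.of_apply,
    Polynomial.coe_mapRingHom, Polynomial.coe_evalRingHom, Polynomial.map_add, Polynomial.eval_add,
    Polynomial.map_map]
  congr 1
  · cases e r s <;> simp
  · congr 1
    convert Polynomial.map_id
    ext x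
    simp

theorem coeff_det_lambdaEntries (he : IndependentEntries e)
    (hL : RowFunctional (lambdaEntries L)) {π : Equiv.Perm ι} {T : Finset ι}
    (h : IsTerm e (lambdaEntries L) π T) :
    Associated ((patternMatrix e (lambdaEntries L)).det.coeff (termExponent e π T))
      (Polynomial.X ^ (Finset.univ \ T).card) := by
  rw [coeff_det_patternMatrix he hL h]
  have : ∏ r ∈ Finset.univ \ T, lambdaEntries L r (π r)
      = ∏ r ∈ Finset.univ \ T, -Polynomial.X :=
    Finset.prod_congr rfl fun r hr => by
      have := h.2 r (by simpa using hr)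
      rw [lambdaEntries_ne_zero] at this
      rw [lambdaEntries, if_pos this]
  rw [this, Finset.prod_const]
  refine (associated_unit_mul_left _ _ ?_).trans ?_
  · rcases Int.units_eq_one_or (Equiv.Perm.sign π) with h1 | h1 <;> simp [h1]
  · exact (Associated.refl (Polynomial.X : Polynomial ℂ)).neg_left.pow_pow

section Factor

variable {P Q : MvPolynomial σ (Polynomial ℂ)}

/-- The determinant has degree at most one in each parameter, and degrees add in a product over a
domain. -/
theorem notMem_vars_of_mul_eq_det (he : IndependentEntries e)
    (hPQ : P * Q = (patternMatrix e (lambdaEntries L)).det)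
    (h0 : P * Q ≠ 0) (t : σ) (ht : t ∈ P.vars) : t ∉ Q.vars := by
  intro ht'
  rw [MvPolynomial.mem_vars_iff_degreeOf_ne_zero] at ht ht'
  have h1 := MvPolynomial.degreeOf_mul_eq (n := t) (left_ne_zero_of_mul h0)
    (right_ne_zero_of_mul h0)
  have h2 : MvPolynomial.degreeOf t (P * Q) ≤ 1 := by
    rw [MvPolynomial.degreeOf_le_iff]
    intro m hm
    rw [MvPolynomial.mem_support_iff, hPQ] at hm
    obtain ⟨π, T, -, rfl⟩ := exists_isTerm_of_coeff_det_ne_zero hm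
    by_cases h : termExponent e π T t = 0
    · omega
    · obtain ⟨r, -, hr⟩ := exists_of_termExponent_ne_zero h
      rw [termExponent_apply he hr]
      split_ifs <;> omega
  omega

/-- By admissibility every parameter lies on some permutation of entries, and the corresponding term
survives in the determinant. -/
theorem mem_vars_or_mem_vars (he : IndependentEntries e) (hL : RowFunctional (lambdaEntries L))
    (hPQ : P * Q = (patternMatrix e (lambdaEntries L)).det)
    (hadm : ∀ r s, IsEntry e L r s → ∃ π : Equiv.Perm ι, π r = s ∧ ∀ r', IsEntry e L r' (π r'))
    {r s : ι} {t : σ} (h : e r s = some t) : t ∈ P.vars ∨ t ∈ Q.vars := by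
  classical
  obtain ⟨π, hπ, hπE⟩ := hadm r s (Or.inl ⟨t, h⟩)
  obtain ⟨T, hT, hTmem⟩ := isTerm_parameters hπE
  have hc := coeff_det_patternMatrix_ne_zero he hL hT
  rw [← hPQ] at hc
  have : t ∈ (P * Q).vars := by
    by_contra hn
    have := apply_eq_zero_of_notMem_vars hc hn
    rw [termExponent_apply he h, if_pos ⟨hTmem r t (by rw [hπ, h]), hπ⟩] at this
    exact absurd this (by norm_num)
  simpa using MvPolynomial.vars_mul P Q this

/-- Two parameters for which no term contains both belong to the same factor. -/
theorem not_both_of_exclusive (he : IndependentEntries e) (hL : RowFunctional (lambdaEntries L))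
    (hPQ : P * Q = (patternMatrix e (lambdaEntries L)).det)
    (hadm : ∀ r s, IsEntry e L r s → ∃ π : Equiv.Perm ι, π r = s ∧ ∀ r', IsEntry e L r' (π r'))
    {r s r' s' : ι} {t t' : σ} (h : e r s = some t) (h' : e r' s' = some t')
    (hex : ∀ π : Equiv.Perm ι, π r = s → π r' ≠ s')
    (ht : t ∈ P.vars) (ht' : t' ∈ Q.vars) : False := by
  obtain ⟨π₁, hπ₁, hE₁⟩ := hadm r s (Or.inl ⟨t, h⟩)
  obtain ⟨T₁, hT₁, hm₁⟩ := isTerm_parameters hE₁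
  obtain ⟨π₂, hπ₂, hE₂⟩ := hadm r' s' (Or.inl ⟨t', h'⟩)
  obtain ⟨T₂, hT₂, hm₂⟩ := isTerm_parameters hE₂
  have hc₁ := coeff_det_patternMatrix_ne_zero he hL hT₁
  have hc₂ := coeff_det_patternMatrix_ne_zero he hL hT₂
  rw [← hPQ] at hc₁ hc₂
  have h0 : P * Q ≠ 0 := by
    intro h
    rw [h] at hc₁
    simp at hc₁
  -- The `P`-part of a term containing `t` and the `Q`-part of a term containing `t'` combine to a
  -- term containing both.
  obtain ⟨m, hm, hP, hQ⟩ := exists_exchange_coeff_ne_zero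
    (notMem_vars_of_mul_eq_det he hPQ h0) hc₁ hc₂
  rw [hPQ] at hm
  obtain ⟨π, T, -, rfl⟩ := exists_isTerm_of_coeff_det_ne_zero hm
  have e₁ := hP t ht
  have e₂ := hQ t' ht'
  rw [termExponent_apply he h, termExponent_apply he h,
    if_pos (c := r ∈ T₁ ∧ _) ⟨hm₁ r t (by rw [hπ₁, h]), hπ₁⟩] at e₁
  rw [termExponent_apply he h', termExponent_apply he h',
    if_pos (c := r' ∈ T₂ ∧ _) ⟨hm₂ r' t' (by rw [hπ₂, h']), hπ₂⟩] at e₂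
  have a₁ : r ∈ T ∧ π r = s := by
    by_contra hn
    rw [if_neg hn] at e₁
    exact absurd e₁ (by norm_num)
  have a₂ : r' ∈ T ∧ π r' = s' := by
    by_contra hn
    rw [if_neg hn] at e₂
    exact absurd e₂ (by norm_num)
  exact hex π a₁.2 a₂.2

/-- The parameters in the row and in the column of a `λ` belong to the same factor. -/
theorem not_both_of_lambda (he : IndependentEntries e) (hL : RowFunctional (lambdaEntries L))
    (hLc : ∀ r r' s, L r s → L r' s → r = r')
    (hPQ : P * Q = (patternMatrix e (lambdaEntries L)).det)
    (hadm : ∀ r s, IsEntry e L r s → ∃ π : Equiv.Perm ι, π r = s ∧ ∀ r', IsEntry e L r' (π r'))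
    {r s c r' : ι} {t t' : σ} (hrc : L r c) (h : e r s = some t) (h' : e r' c = some t')
    (ht : t ∈ P.vars) (ht' : t' ∈ Q.vars) : False := by
  have hcol : ∀ {r₁ r₂ : ι} {t₁ t₂ : σ}, e r₁ c = some t₁ → e r₂ c = some t₂ → t₁ ∈ P.vars →
      t₂ ∈ Q.vars → r₁ ≠ r₂ → False := fun h₁ h₂ ht₁ ht₂ hne =>
    not_both_of_exclusive he hL hPQ hadm h₁ h₂
      (fun π hπ hπ' => hne (π.injective (hπ.trans hπ'.symm))) ht₁ ht₂
  obtain ⟨π₁, hπ₁, hE₁⟩ := hadm r s (Or.inl ⟨t, h⟩)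
  obtain ⟨T₁, hT₁, hm₁⟩ := isTerm_parameters hE₁
  obtain ⟨π₂, hπ₂, hE₂⟩ := hadm r c (Or.inr hrc)
  obtain ⟨T₂, hT₂, hm₂⟩ := isTerm_lambdas hE₂
  have hc₁ := coeff_det_patternMatrix_ne_zero he hL hT₁
  have hc₂ := coeff_det_patternMatrix_ne_zero he hL hT₂
  rw [← hPQ] at hc₁ hc₂
  have h0 : P * Q ≠ 0 := by
    intro h
    rw [h] at hc₁
    simp at hc₁
  have hdisj := notMem_vars_of_mul_eq_det he hPQ h0
  -- The combined term has the `P`-part of a term using `t` at `(r, s)` and the `Q`-part of a term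
  -- using λ at `(r, c)`.
  obtain ⟨m, hm, hP, hQ⟩ := exists_exchange_coeff_ne_zero hdisj hc₁ hc₂
  rw [hPQ] at hm
  obtain ⟨π, T, hT, rfl⟩ := exists_isTerm_of_coeff_det_ne_zero hm
  have e₁ := hP t ht
  rw [termExponent_apply he h, termExponent_apply he h,
    if_pos (c := r ∈ T₁ ∧ _) ⟨hm₁ r t (by rw [hπ₁, h]), hπ₁⟩] at e₁
  have a₁ : r ∈ T ∧ π r = s := by
    by_contra hn
    rw [if_neg hn] at e₁
    exact absurd e₁ (by norm_num)
  have hr'' : π (π.symm c) = c := π.apply_symm_apply c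
  -- No entry can cover column `c` in the combined term. A parameter of `P` clashes with `t'`, which
  -- lies in `Q` and in the same column; a parameter of `Q` would occur in the second term, where λ
  -- covers `c`; and the only λ of the column lies in row `r`, which already uses `t`.
  by_cases hmem : π.symm c ∈ T
  · obtain ⟨t₃, ht₃⟩ := hT.1 _ hmem
    rw [hr''] at ht₃
    rcases mem_vars_or_mem_vars he hL hPQ hadm ht₃ with h3 | h3
    · by_cases hne : π.symm c = r'
      · rw [hne, h'] at ht₃
        obtain rfl : t' = t₃ := Option.some.inj ht₃
        exact hdisj _ h3 ht'
      · exact hcol ht₃ h' h3 ht' hne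
    · have e₂ := hQ t₃ h3
      rw [termExponent_apply he ht₃, termExponent_apply he ht₃,
        if_pos (c := π.symm c ∈ T ∧ _) ⟨hmem, hr''⟩] at e₂
      have a₂ : π.symm c ∈ T₂ ∧ π₂ (π.symm c) = c := by
        by_contra hn
        rw [if_neg hn] at e₂
        exact absurd e₂ (by norm_num)
      have : π.symm c = r := π₂.injective (a₂.2.trans hπ₂.symm)
      rw [this, hm₂, hπ₂] at a₂
      exact a₂.1 hrc
  · have h3 := hT.2 _ hmem
    rw [hr'', lambdaEntries_ne_zero] at h3
    rw [hLc _ _ _ h3 hrc] at hmem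
    exact hmem a₁.1

end Factor

/-- A factor of the determinant of a connected pencil that is neither constant nor divisible by
`λ` contains parameters from all columns. -/
theorem exists_parameter_mem_vars_of_dvd_det (he : IndependentEntries e)
    (hL : RowFunctional (lambdaEntries L)) (hLc : ∀ r r' s, L r s → L r' s → r = r')
    (hadm : ∀ r s, IsEntry e L r s → ∃ π : Equiv.Perm ι, π r = s ∧ ∀ r', IsEntry e L r' (π r'))
    (hdiag : ∀ r, IsEntry e L r r)
    (hconn : ∀ S : Set ι, S.Nonempty → (∀ r s, IsEntry e L r s → (r ∈ S ↔ s ∈ S)) → ∀ r, r ∈ S)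
    {p : Polynomial (MvPolynomial σ ℂ)} (hp : p ∣ (parametricPencil e (lambdaEntries L)).det)
    (hd : p.natDegree ≠ 0) (hX : ¬ Polynomial.X ∣ p) (c : ι) :
    ∃ r t, e r c = some t ∧ t ∈ (swapVariables σ p).vars := by
  obtain ⟨q, hq⟩ := hp
  have hPQ : swapVariables σ p * swapVariables σ q = (patternMatrix e (lambdaEntries L)).det := by
    rw [← map_mul, ← hq, swapVariables_det]
  have hQP : swapVariables σ q * swapVariables σ p = (patternMatrix e (lambdaEntries L)).det := by
    rw [mul_comm, hPQ]
  set P := swapVariables σ p with hPdef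
  set Q := swapVariables σ q with hQdef
  obtain ⟨T₀, hT₀, -⟩ := isTerm_parameters (π := Equiv.refl ι) hdiag
  have hc₀ := coeff_det_patternMatrix_ne_zero he hL hT₀
  have h0 : P * Q ≠ 0 := by
    intro h
    rw [← hPQ, h] at hc₀
    simp at hc₀
  -- A factor free of parameters lies in `ℂ[λ]` and divides each coefficient of the determinant,
  -- hence a power of λ. It would then be constant or divisible by λ.
  have hPvars : P.vars.Nonempty := by
    rw [Finset.nonempty_iff_ne_empty]
    intro hempty
    obtain ⟨p₀, hp₀⟩ : ∃ p₀, P = MvPolynomial.C p₀ := by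
      rw [MvPolynomial.vars_eq_empty_iff_eq_C] at hempty
      exact ⟨_, hempty⟩
    have hpm : p = p₀.map MvPolynomial.C := by
      apply swapVariables_injective
      rw [← hPdef, hp₀, swapVariables_map_C]
    have hdvd : p₀ ∣ Polynomial.X ^ (Finset.univ \ T₀).card := by
      refine Dvd.dvd.trans ?_ (coeff_det_lambdaEntries he hL hT₀).dvd
      rw [← hPQ, hp₀, MvPolynomial.coeff_C_mul]
      exact dvd_mul_right _ _
    obtain ⟨k, -, hk⟩ := (dvd_prime_pow Polynomial.prime_X _).1 hdvd
    rcases Nat.eq_zero_or_pos k with rfl | hk0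
    · rw [pow_zero, associated_one_iff_isUnit] at hk
      apply hd
      rw [hpm, Polynomial.natDegree_map_eq_of_injective (MvPolynomial.C_injective σ ℂ)]
      exact Polynomial.natDegree_eq_zero_of_isUnit hk
    · apply hX
      have h1 : Polynomial.X ∣ p₀ := (dvd_pow_self _ hk0.ne').trans hk.symm.dvd
      have h2 := map_dvd (Polynomial.mapRingHom (MvPolynomial.C (σ := σ) (R := ℂ))) h1
      simpa [hpm] using h2
  have hrow : ∀ {r s s' : ι} {t t' : σ}, e r s = some t → e r s' = some t' → t ∈ P.vars →
      t' ∈ Q.vars → False := by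
    intro r s s' t t' h h' ht ht'
    by_cases hs : s = s'
    · subst hs
      rw [h] at h'
      obtain rfl := Option.some.inj h'
      exact notMem_vars_of_mul_eq_det he hPQ h0 _ ht ht'
    · exact not_both_of_exclusive he hL hPQ hadm h h'
        (fun π hπ hπ' => hs (hπ.symm.trans hπ')) ht ht'
  have hcol : ∀ {r r' s : ι} {t t' : σ}, e r s = some t → e r' s = some t' → t ∈ P.vars →
      t' ∈ Q.vars → False := by
    intro r r' s t t' h h' ht ht'
    by_cases hr : r = r'
    · subst hr
      exact hrow h h' ht ht'
    · exact not_both_of_exclusive he hL hPQ hadm h h'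
        (fun π hπ hπ' => hr (π.injective (hπ.trans hπ'.symm))) ht ht'
  have hmem := fun {r s : ι} {t : σ} (h : e r s = some t) =>
    mem_vars_or_mem_vars he hL hPQ hadm h
  -- Along each entry, its row has a parameter in `P` iff its column does. The diagonal entries then
  -- identify the rows with this property with the columns, and connectedness applies.
  have hclosed : ∀ r c, IsEntry e L r c →
      ((∃ s t, e r s = some t ∧ t ∈ P.vars) ↔ ∃ s t, e s c = some t ∧ t ∈ P.vars) := by
    intro r c hrc
    rcases hx : e r c with _ | t'
    · have hLrc : L r c := hrc.resolve_left (by simp [hx])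
      constructor
      · rintro ⟨s, t, h, ht⟩
        obtain ⟨π, hπ, hE⟩ := hadm r s (Or.inl ⟨t, h⟩)
        have hne : π.symm c ≠ r := by
          intro h'
          have : c = s := by rw [← hπ, ← h', π.apply_symm_apply]
          rw [this, h] at hx
          exact Option.some_ne_none _ hx
        have hE' := hE (π.symm c)
        rw [π.apply_symm_apply] at hE'
        obtain ⟨t', ht'⟩ := hE'.resolve_right fun h' => hne (hLc _ _ _ h' hLrc)
        rcases hmem ht' with h1 | h1
        · exact ⟨_, _, ht', h1⟩
        · exact (not_both_of_lambda he hL hLc hPQ hadm hLrc h ht' ht h1).elim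
      · rintro ⟨r', t, h, ht⟩
        obtain ⟨π, hπ, hE⟩ := hadm r' c (Or.inl ⟨t, h⟩)
        have hne : π r ≠ c := by
          intro h'
          have : r = r' := π.injective (h'.trans hπ.symm)
          rw [this, h] at hx
          exact Option.some_ne_none _ hx
        obtain ⟨t', ht'⟩ := (hE r).resolve_right fun h' => hne
          (hL _ _ _ (lambdaEntries_ne_zero.2 h') (lambdaEntries_ne_zero.2 hLrc))
        rcases hmem ht' with h1 | h1
        · exact ⟨_, _, ht', h1⟩
        · exact (not_both_of_lambda he hL hLc hQP hadm hLrc ht' h h1 ht).elim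
    · constructor
      · rintro ⟨s, t, h, ht⟩
        rcases hmem hx with h1 | h1
        · exact ⟨_, _, hx, h1⟩
        · exact (hrow h hx ht h1).elim
      · rintro ⟨s, t, h, ht⟩
        rcases hmem hx with h1 | h1
        · exact ⟨_, _, hx, h1⟩
        · exact (hcol h hx ht h1).elim
  have hall := hconn {r | ∃ s t, e r s = some t ∧ t ∈ P.vars} (by
    obtain ⟨t, ht⟩ := hPvars
    have : t ∈ (P * Q).vars := by
      rw [MvPolynomial.mem_vars_iff_degreeOf_ne_zero] at ht ⊢
      rw [MvPolynomial.degreeOf_mul_eq (left_ne_zero_of_mul h0) (right_ne_zero_of_mul h0)]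
      omega
    obtain ⟨m, hm, hmt⟩ := (MvPolynomial.mem_vars_iff_mem_support t).1 this
    rw [MvPolynomial.mem_support_iff, hPQ] at hm
    obtain ⟨π, T, -, rfl⟩ := exists_isTerm_of_coeff_det_ne_zero hm
    obtain ⟨r, -, hr⟩ := exists_of_termExponent_ne_zero (Finsupp.mem_support_iff.1 hmt)
    exact ⟨r, _, t, hr, ht⟩) (by
    intro r c hrc
    exact (hclosed r c hrc).trans (hclosed c c (hdiag c)).symm)
  exact (hclosed c c (hdiag c)).1 (hall c)

/-- If all terms of the determinant have the same degree in `λ`, then generically it has no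
nonzero root. -/
theorem exists_generic_no_root (he : IndependentEntries e)
    (hL : RowFunctional (lambdaEntries L)) (hdiag : ∀ r, IsEntry e L r r)
    (hdeg : ∀ π T π' T', IsTerm e (lambdaEntries L) π T → IsTerm e (lambdaEntries L) π' T' →
      T.card = T'.card) :
    ∃ r : MvPolynomial σ ℂ, r ≠ 0 ∧ ∀ θ : σ → ℂ, MvPolynomial.eval θ r ≠ 0 → ∀ z : ℂ,
      ((parametricPencil e (lambdaEntries L)).det.map (MvPolynomial.eval θ)).eval z = 0 →
        z = 0 := by
  obtain ⟨T₀, hT₀, -⟩ := isTerm_parameters (π := Equiv.refl ι) hdiag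
  set D := (parametricPencil e (lambdaEntries L)).det with hD
  set g := (Finset.univ \ T₀).card with hg
  -- Every coefficient of `D` in the parameters is, up to a unit, a power of λ, and by hypothesis
  -- the exponent is always `g`.
  have hmono : D = Polynomial.C (D.coeff g) * Polynomial.X ^ g := by
    ext k m
    rw [Polynomial.coeff_C_mul_X_pow]
    split_ifs with h
    · rw [h]
    · by_contra hne
      rw [MvPolynomial.coeff_zero, ← coeff_swapVariables, swapVariables_det] at hne
      have hne' : (patternMatrix e (lambdaEntries L)).det.coeff m ≠ 0 := by
        intro h0
        simp [h0] at hne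
      obtain ⟨π, T, hT, rfl⟩ := exists_isTerm_of_coeff_det_ne_zero hne'
      obtain ⟨u, hu⟩ := (coeff_det_lambdaEntries he hL hT).symm
      rw [← hu] at hne
      obtain ⟨a, -, ha⟩ := Polynomial.isUnit_iff.1 u.isUnit
      rw [← ha, mul_comm, Polynomial.coeff_C_mul_X_pow, if_neg] at hne
      · exact hne rfl
      · rw [Finset.card_univ_sdiff, hdeg _ _ _ _ hT hT₀, ← Finset.card_univ_sdiff]
        exact h
  refine ⟨D.coeff g, ?_, fun θ hθ z hz => ?_⟩
  · intro h
    have h1 := coeff_det_patternMatrix_ne_zero he hL hT₀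
    rw [← swapVariables_det, ← hD, hmono, h] at h1
    simp at h1
  · rw [hmono] at hz
    simp only [Polynomial.map_mul, Polynomial.map_C, Polynomial.map_pow, Polynomial.map_X,
      Polynomial.eval_mul, Polynomial.eval_C, Polynomial.eval_pow, Polynomial.eval_X] at hz
    rcases mul_eq_zero.1 hz with h | h
    · exact absurd h hθ
    · exact eq_zero_of_pow_eq_zero h

theorem exists_irreducible_factor_natDegree_ne_zero {R : Type} [CommRing R] [IsDomain R]
    [UniqueFactorizationMonoid R] (a : Polynomial R) (ha : a ≠ 0) (hd : a.natDegree ≠ 0) :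
    ∃ p, Irreducible p ∧ p ∣ a ∧ p.natDegree ≠ 0 := by
  induction a using WfDvdMonoid.induction_on_irreducible with
  | zero => exact absurd rfl ha
  | unit u hu => exact absurd (Polynomial.natDegree_eq_zero_of_isUnit hu) hd
  | mul a i ha0 hi ih =>
    by_cases h : i.natDegree = 0
    · rw [Polynomial.natDegree_mul hi.ne_zero ha0, h, zero_add] at hd
      obtain ⟨p, h1, h2, h3⟩ := ih ha0 hd
      exact ⟨p, h1, h2.mul_left _, h3⟩
    · exact ⟨i, hi, dvd_mul_right _ _, h⟩

/-- After the highest power of the variable is split off, the cofactor is not constant, since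
otherwise `a` would have only one nonzero coefficient. An irreducible factor of the cofactor with
positive degree serves. -/
theorem exists_irreducible_factor_not_X_dvd {R : Type} [CommRing R] [IsDomain R]
    [UniqueFactorizationMonoid R] (a : Polynomial R) {g h : ℕ} (hgh : g ≠ h)
    (hg : a.coeff g ≠ 0) (hh : a.coeff h ≠ 0) :
    ∃ p, Irreducible p ∧ p ∣ a ∧ p.natDegree ≠ 0 ∧ ¬ Polynomial.X ∣ p := by
  have ha : a ≠ 0 := by
    rintro rfl
    simp at hg
  obtain ⟨k, b, hXb, hab⟩ := WfDvdMonoid.max_power_factor ha (Polynomial.irreducible_X (R := R))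
  have hb : b ≠ 0 := by
    rintro rfl
    simp at hXb
  obtain ⟨p, h1, h2, h3⟩ := exists_irreducible_factor_natDegree_ne_zero b hb (by
    intro h0
    obtain ⟨x, hx⟩ := Polynomial.natDegree_eq_zero.1 h0
    rw [hab, ← hx, mul_comm, Polynomial.coeff_C_mul_X_pow] at hg hh
    have e1 : g = k := by
      by_contra hn
      rw [if_neg hn] at hg
      exact hg rfl
    have e2 : h = k := by
      by_contra hn
      rw [if_neg hn] at hh
      exact hh rfl
    exact hgh (e1.trans e2.symm))
  exact ⟨p, h1, hab ▸ h2.mul_left _, h3, fun h => hXb (h.trans h2)⟩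

/-- If the determinant of a connected pencil has terms of different degrees in `λ`, then
generically it has a nonzero root which is no root of a given nonzero polynomial in which no
parameter of a certain column occurs. -/
theorem exists_generic_nonzero_root (he : IndependentEntries e)
    (hL : RowFunctional (lambdaEntries L)) (hLc : ∀ r r' s, L r s → L r' s → r = r')
    (hadm : ∀ r s, IsEntry e L r s → ∃ π : Equiv.Perm ι, π r = s ∧ ∀ r', IsEntry e L r' (π r'))
    (hdiag : ∀ r, IsEntry e L r r)
    (hconn : ∀ S : Set ι, S.Nonempty → (∀ r s, IsEntry e L r s → (r ∈ S ↔ s ∈ S)) → ∀ r, r ∈ S)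
    {π π' : Equiv.Perm ι} {T T' : Finset ι} (hT : IsTerm e (lambdaEntries L) π T)
    (hT' : IsTerm e (lambdaEntries L) π' T') (hne : T.card ≠ T'.card)
    {a : Polynomial (MvPolynomial σ ℂ)} (ha : a ≠ 0) (c : ι)
    (hac : ∀ r t, e r c = some t → t ∉ (swapVariables σ a).vars) :
    ∃ r : MvPolynomial σ ℂ, r ≠ 0 ∧ ∀ θ : σ → ℂ, MvPolynomial.eval θ r ≠ 0 → ∃ z : ℂ, z ≠ 0 ∧
      ((parametricPencil e (lambdaEntries L)).det.map (MvPolynomial.eval θ)).eval z = 0 ∧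
        (a.map (MvPolynomial.eval θ)).eval z ≠ 0 := by
  have hcoeff : ∀ {π : Equiv.Perm ι} {T : Finset ι}, IsTerm e (lambdaEntries L) π T →
      (parametricPencil e (lambdaEntries L)).det.coeff (Finset.univ \ T).card ≠ 0 := by
    intro π T hT h
    have h1 := congrArg (MvPolynomial.coeff (termExponent e π T)) h
    rw [← coeff_swapVariables, swapVariables_det] at h1
    obtain ⟨u, hu⟩ := (coeff_det_lambdaEntries he hL hT).symm
    obtain ⟨x, hx, hxu⟩ := Polynomial.isUnit_iff.1 u.isUnit
    rw [← hu, ← hxu, mul_comm, Polynomial.coeff_C_mul_X_pow, if_pos rfl,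
      MvPolynomial.coeff_zero] at h1
    exact hx.ne_zero h1
  obtain ⟨p, hp, hpD, hd, hX⟩ := exists_irreducible_factor_not_X_dvd _ (g := (Finset.univ \ T).card)
    (h := (Finset.univ \ T').card) (by
      rw [Finset.card_univ_sdiff, Finset.card_univ_sdiff]
      have := Finset.card_le_univ T
      have := Finset.card_le_univ T'
      omega) (hcoeff hT) (hcoeff hT')
  obtain ⟨r, t, hrt, ht⟩ :=
    exists_parameter_mem_vars_of_dvd_det he hL hLc hadm hdiag hconn hpD hd hX c
  -- The factor `p` involves the parameter `t` of column `c`, and so would every nonzero multiple of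
  -- `p`; `a` does not.
  obtain ⟨ρ, hρ, h⟩ := exists_generic_root p a hp hd hX (by
    rintro ⟨b, rfl⟩
    apply hac r t hrt
    have h0 : swapVariables σ (p * b) ≠ 0 := by
      rw [Ne, map_eq_zero_iff _ (swapVariables_injective σ)]
      exact ha
    rw [map_mul] at h0 ⊢
    rw [MvPolynomial.mem_vars_iff_degreeOf_ne_zero] at ht ⊢
    rw [MvPolynomial.degreeOf_mul_eq (left_ne_zero_of_mul h0) (right_ne_zero_of_mul h0)]
    omega)
  refine ⟨ρ, hρ, fun θ hθ => ?_⟩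
  obtain ⟨z, hz, hpz, haz⟩ := h θ hθ
  refine ⟨z, hz, ?_, haz⟩
  obtain ⟨b, hb⟩ := hpD
  rw [hb, Polynomial.map_mul, Polynomial.eval_mul, hpz, zero_mul]

end Pencil

/-! ### Minors of a pencil -/

section Minor

variable {ι σ : Type} [DecidableEq ι]

/-- The parameters of `e` outside the row `i`. -/
def eraseRow (e : ι → ι → Option σ) (i r s : ι) : Option σ := if r = i then none else e r s

/-- The constant entries `l`, with the row `i` replaced by the unit vector at `c`. -/
def unitRow (l : ι → ι → Polynomial ℂ) (i c r s : ι) : Polynomial ℂ :=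
  if r = i then (if s = c then 1 else 0) else l r s

theorem IndependentEntries.eraseRow {e : ι → ι → Option σ} (he : IndependentEntries e) (i : ι) :
    IndependentEntries (eraseRow e i) := by
  intro r s r' s' t h h'
  unfold _root_.eraseRow at h h'
  split_ifs at h h'
  exact he _ _ _ _ _ h h'

theorem RowFunctional.unitRow {l : ι → ι → Polynomial ℂ} (hl : RowFunctional l) (i c : ι) :
    RowFunctional (unitRow l i c) := by
  intro r s s' h h'
  unfold _root_.unitRow at h h'
  split_ifs at h h' with h1 h2 h3
  · rw [h2, h3]
  · exact absurd rfl h'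
  · exact absurd rfl h
  · exact absurd rfl h
  · exact hl _ _ _ h h'

variable [Fintype ι] {e : ι → ι → Option σ} {L : ι → ι → Prop} [∀ r s, Decidable (L r s)]

/-- The minor without the row `i` and the column `c`, up to sign. -/
def pencilMinor (e : ι → ι → Option σ) (L : ι → ι → Prop) [∀ r s, Decidable (L r s)] (i c : ι) :
    Polynomial (MvPolynomial σ ℂ) :=
  (parametricPencil (eraseRow e i) (unitRow (lambdaEntries L) i c)).det

/-- The unit row contributes the factor 1 at `(i, c)`, so `π` yields a term, and terms do not
cancel. -/
theorem pencilMinor_ne_zero (he : IndependentEntries e) (hL : RowFunctional (lambdaEntries L))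
    {i c : ι} {π : Equiv.Perm ι} (hπ : π i = c) (hE : ∀ r, r ≠ i → IsEntry e L r (π r)) :
    pencilMinor e L i c ≠ 0 := by
  classical
  set T := Finset.univ.filter fun r => r ≠ i ∧ ∃ t, e r (π r) = some t with hTdef
  have hT : IsTerm (eraseRow e i) (unitRow (lambdaEntries L) i c) π T := by
    refine ⟨fun r hr => ?_, fun r hr => ?_⟩
    · obtain ⟨hr, h⟩ : r ≠ i ∧ ∃ t, e r (π r) = some t := by simpa [hTdef] using hr
      simpa [eraseRow, hr] using h
    · by_cases h : r = i
      · simp [unitRow, h, hπ]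
      · have h' : ¬ ∃ t, e r (π r) = some t := by
          intro h'
          exact hr (by simpa [hTdef, h] using h')
        simpa [unitRow, h] using lambdaEntries_ne_zero.2 ((hE r h).resolve_left h')
  have h1 := coeff_det_patternMatrix_ne_zero (he.eraseRow i) (hL.unitRow i c) hT
  intro h0
  rw [← swapVariables_det] at h1
  unfold pencilMinor at h0
  rw [h0] at h1
  simp at h1

/-- In every term row `i` occupies column `c`, which leaves that column to no other row. -/
theorem notMem_vars_pencilMinor (he : IndependentEntries e) {i c r : ι} {t : σ}
    (h : e r c = some t) : t ∉ (swapVariables σ (pencilMinor e L i c)).vars := by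
  intro ht
  obtain ⟨m, hm, hmt⟩ := (MvPolynomial.mem_vars_iff_mem_support t).1 ht
  rw [MvPolynomial.mem_support_iff, pencilMinor, swapVariables_det] at hm
  obtain ⟨π, T, hT, rfl⟩ := exists_isTerm_of_coeff_det_ne_zero hm
  obtain ⟨r', hr', hx⟩ := exists_of_termExponent_ne_zero (Finsupp.mem_support_iff.1 hmt)
  have hiT : i ∉ T := by
    intro hi
    obtain ⟨t', ht'⟩ := hT.1 i hi
    simp [eraseRow] at ht'
  have hi := hT.2 i hiT
  have hπ : π i = c := by
    by_contra hn
    simp [unitRow, hn] at hi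
  have hne : r' ≠ i := fun h' => hiT (h' ▸ hr')
  rw [eraseRow, if_neg hne] at hx
  obtain ⟨-, h2⟩ := he _ _ _ _ _ hx h
  exact hne (π.injective (h2.trans hπ.symm))

/-- The value of the pencil at the parameters `θ` and at `λ = z`. -/
def pencilValue (e : ι → ι → Option σ) (L : ι → ι → Prop) [∀ r s, Decidable (L r s)]
    (θ : σ → ℂ) (z : ℂ) : Matrix ι ι ℂ :=
  Matrix.of fun r s => (e r s).elim 0 θ + (lambdaEntries L r s).eval z

theorem eval_pencilMinor (i c : ι) (θ : σ → ℂ) (z : ℂ) :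
    ((pencilMinor e L i c).map (MvPolynomial.eval θ)).eval z
      = ((pencilValue e L θ z).updateRow i (Pi.single c 1)).det := by
  rw [pencilMinor, eval_det_parametricPencil]
  congr 1
  ext r s
  by_cases h : r = i
  · subst h
    by_cases h' : s = c
    · simp [eraseRow, unitRow, h']
    · simp [eraseRow, unitRow, h']
  · simp [eraseRow, unitRow, h, pencilValue]

theorem exists_perm_of_pencilMinor_ne_zero {i c : ι} {θ : σ → ℂ} {z : ℂ}
    (h : ((pencilValue e L θ z).updateRow i (Pi.single c 1)).det ≠ 0) :
    ∃ π : Equiv.Perm ι, π i = c ∧ ∀ r, r ≠ i → IsEntry e L r (π r) := by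
  rw [← Matrix.det_transpose, Matrix.det_apply'] at h
  obtain ⟨π, -, hπ⟩ := Finset.exists_ne_zero_of_sum_ne_zero h
  have h1 := Finset.prod_ne_zero_iff.1 (right_ne_zero_of_mul hπ)
  refine ⟨π, ?_, fun r hr => ?_⟩
  · by_contra hn
    have := h1 i (Finset.mem_univ _)
    simp [hn] at this
  · have := h1 r (Finset.mem_univ _)
    rw [Matrix.transpose_apply, Matrix.updateRow_ne hr] at this
    by_contra hn
    rw [IsEntry, not_or] at hn
    apply this
    have e1 : e r (π r) = none := by
      rcases hx : e r (π r) with _ | t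
      · rfl
      · exact absurd ⟨t, hx⟩ hn.1
    have e2 : lambdaEntries L r (π r) = 0 := by
      by_contra h'
      exact hn.2 (lambdaEntries_ne_zero.1 h')
    simp [pencilValue, e1, e2]

end Minor

/-! ### Reachability -/

section Reachability

variable {n : ℕ}

theorem IsControllable.eq_zero_of_vecMul {A : Matrix (Fin n) (Fin n) ℂ} {b : Fin n → ℂ}
    (h : IsControllable A b) {q : Fin n → ℂ}
    (hq : Matrix.vecMul q (controllabilityMatrix A b) = 0) : q = 0 := by
  have hr : LinearMap.range (controllabilityMatrix A b).mulVecLin = ⊤ := by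
    apply Submodule.eq_top_of_finrank_eq
    rw [← Matrix.rank, h]
    simp
  apply dotProduct_eq_zero q
  intro w
  obtain ⟨v, hv⟩ : w ∈ LinearMap.range (controllabilityMatrix A b).mulVecLin := hr ▸ trivial
  rw [← hv, Matrix.mulVecLin_apply, Matrix.dotProduct_mulVec, hq, zero_dotProduct]

/-- A left eigenvector of `A` for a controllable pair is not orthogonal to `b`. -/
theorem IsControllable.eq_zero_of_eigenvector {A : Matrix (Fin n) (Fin n) ℂ} {b : Fin n → ℂ}
    (h : IsControllable A b) {q : Fin n → ℂ} {z : ℂ}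
    (hA : Matrix.vecMul q A = z • q) (hb : q ⬝ᵥ b = 0) : q = 0 := by
  apply h.eq_zero_of_vecMul
  have hpow : ∀ k : ℕ, Matrix.vecMul q (A ^ k) = z ^ k • q := by
    intro k
    induction k with
    | zero => simp
    | succ k ih => rw [pow_succ, ← Matrix.vecMul_vecMul, ih, Matrix.smul_vecMul, hA, smul_smul,
        pow_succ]
  funext k
  have : Matrix.vecMul q (controllabilityMatrix A b) k = q ⬝ᵥ (A ^ (k : ℕ)).mulVec b := rfl
  rw [this, Matrix.dotProduct_mulVec, hpow, smul_dotProduct, hb, smul_zero]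
  rfl

/-- The column vertex `c` can be reached from the input in at most `t` steps. -/
def ReachableWithin (H : StructuredMatrix (Fin n) (Fin (n + 1))) : ℕ → Fin (n + 1) → Prop
  | 0, c => c = Fin.last n
  | t + 1, c => ReachableWithin H t c ∨
      ∃ r a, c = Fin.castSucc r ∧ ReachableWithin H t a ∧ H r a = true

/-- If a state is unreachable from the input, its coordinate vanishes in every `A ^ k b`, and the
controllability matrix has a zero row. -/
theorem exists_reachableWithin {A' : StructuredMatrix (Fin n) (Fin n)} {b' : Fin n → Bool}
    (h : StructurallyControllable A' b') (c : Fin (n + 1)) :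
    ∃ t, ReachableWithin (augment A' b') t c := by
  obtain ⟨A, b, hAb, hc⟩ := h
  by_contra hn
  induction c using Fin.lastCases with
  | last => exact hn ⟨0, rfl⟩
  | cast r₀ =>
    have hpow : ∀ (k : ℕ) (r : Fin n),
        (¬ ∃ t, ReachableWithin (augment A' b') t r.castSucc) → (A ^ k).mulVec b r = 0 := by
      intro k
      induction k with
      | zero =>
        intro r hr
        have : augment A' b' r (Fin.last n) = false := by
          by_contra h
          exact hr ⟨1, Or.inr ⟨r, Fin.last n, rfl, rfl, by simpa using h⟩⟩
        simpa [augment] using hAb r (Fin.last n) this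
      | succ k ih =>
        intro r hr
        rw [pow_succ', ← Matrix.mulVec_mulVec]
        change ∑ a, A r a * (A ^ k).mulVec b a = 0
        refine Finset.sum_eq_zero fun a _ => ?_
        by_cases ha : ∃ t, ReachableWithin (augment A' b') t a.castSucc
        · obtain ⟨t, ht⟩ := ha
          have : augment A' b' r a.castSucc = false := by
            by_contra h
            exact hr ⟨t + 1, Or.inr ⟨r, _, rfl, ht, by simpa using h⟩⟩
          have := hAb r a.castSucc this
          rw [show A r a = 0 by simpa [augment] using this, zero_mul]
        · rw [ih a ha, mul_zero]
    have hq := hc.eq_zero_of_vecMul (q := Pi.single r₀ 1) (by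
      funext k
      rw [Matrix.single_one_vecMul]
      exact hpow k r₀ hn)
    have := congrFun hq r₀
    simp at this

/-- An alternating path argument: the λ-edges miss the input column, and each step of the path moves
the missed column one vertex further. The last clause carries the induction: a row not reached so
far still uses its λ-edge, so rematching it frees exactly its own column. -/
theorem exists_matching_avoiding {H : StructuredMatrix (Fin n) (Fin (n + 1))} :
    ∀ (t : ℕ) (j : Fin (n + 1)), ReachableWithin H t j →
      ∃ f : Fin n → Fin (n + 1), Function.Injective f ∧
        (∀ r, f r = r.castSucc ∨ H r (f r) = true) ∧ (∀ r, f r ≠ j) ∧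
          ∀ r, ¬ ReachableWithin H t r.castSucc → f r = r.castSucc := by
  intro t
  induction t with
  | zero =>
    rintro j rfl
    exact ⟨Fin.castSucc, Fin.castSucc_injective n, fun r => Or.inl rfl,
      fun r => (Fin.castSucc_lt_last r).ne, fun r _ => rfl⟩
  | succ t ih =>
    intro j hj
    by_cases hjt : ReachableWithin H t j
    · obtain ⟨f, h1, h2, h3, h4⟩ := ih j hjt
      exact ⟨f, h1, h2, h3, fun r hr => h4 r fun h => hr (Or.inl h)⟩
    · obtain ⟨r₀, a, rfl, ha, hra⟩ := hj.resolve_left hjt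
      obtain ⟨f, h1, h2, h3, h4⟩ := ih a ha
      have h5 := h4 r₀ hjt
      refine ⟨Function.update f r₀ a, ?_, fun r => ?_, fun r => ?_, fun r hr => ?_⟩
      · intro r r' h
        by_cases hr : r = r₀ <;> by_cases hr' : r' = r₀
        · rw [hr, hr']
        · rw [hr, Function.update_self, Function.update_of_ne hr'] at h
          exact absurd h.symm (h3 r')
        · rw [hr', Function.update_self, Function.update_of_ne hr] at h
          exact absurd h (h3 r)
        · rw [Function.update_of_ne hr, Function.update_of_ne hr'] at h
          exact h1 h
      · by_cases hr : r = r₀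
        · rw [hr, Function.update_self]
          exact Or.inr hra
        · rw [Function.update_of_ne hr]
          exact h2 r
      · by_cases hr : r = r₀
        · rw [hr, Function.update_self]
          rintro rfl
          exact hjt ha
        · rw [Function.update_of_ne hr, ← h5]
          exact fun h => hr (h1 h)
      · have hr₀ : r ≠ r₀ := by
          rintro rfl
          exact hr (Or.inr ⟨r, a, rfl, ha, hra⟩)
        rw [Function.update_of_ne hr₀]
        exact h4 r fun h => hr (Or.inl h)

theorem mem_edges_pencilGraphDelete {H : StructuredMatrix (Fin n) (Fin (n + 1))}
    {j : Fin (n + 1)} {e : Fin n × Fin (n + 1)} :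
    e ∈ (pencilGraphDelete H j).edges ↔
      (e.2 = e.1.castSucc ∨ H e.1 e.2 = true) ∧ e.2 ≠ j := by
  simp [pencilGraphDelete, BipartiteGraph.induce, pencilGraph]

/-- A structurally controllable pair has a matching of all row vertices to the column vertices
other than `v_j`. -/
theorem exists_perfect_matching {A' : StructuredMatrix (Fin n) (Fin n)} {b' : Fin n → Bool}
    (h : StructurallyControllable A' b') (j : Fin (n + 1)) :
    ∃ f : Fin n → Fin (n + 1), Function.Injective f ∧
      ∀ r, (r, f r) ∈ (pencilGraphDelete (augment A' b') j).edges := by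
  obtain ⟨t, ht⟩ := exists_reachableWithin h j
  obtain ⟨f, h1, h2, h3, -⟩ := exists_matching_avoiding t j ht
  exact ⟨f, h1, fun r => mem_edges_pencilGraphDelete.2 ⟨h2 r, h3 r⟩⟩

theorem exists_eq_of_ne {f : Fin n → Fin (n + 1)} (hf : Function.Injective f) {j : Fin (n + 1)}
    (hj : ∀ r, f r ≠ j) {c : Fin (n + 1)} (hc : c ≠ j) : ∃ r, f r = c := by
  have : Finset.univ.image f = Finset.univ.erase j := by
    apply Finset.eq_of_subset_of_card_le
    · intro c hc
      obtain ⟨r, -, rfl⟩ := Finset.mem_image.1 hc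
      simpa using hj r
    · rw [Finset.card_image_of_injective _ hf, Finset.card_erase_of_mem (Finset.mem_univ _)]
      simp
  have hc' : c ∈ Finset.univ.image f := by
    rw [this]
    simpa using hc
  obtain ⟨r, -, hr⟩ := Finset.mem_image.1 hc'
  exact ⟨r, hr⟩

end Reachability

/-! ### Block decompositions of graphs with a perfect matching -/

namespace BipartiteGraph

variable {V W : Type}

theorem mt_eq_card {G : BipartiteGraph V W} {M : Finset (V × W)} (hM : G.IsMaximumMatching M) :
    G.mt = M.card := by
  apply IsGreatest.csSup_eq
  refine ⟨⟨M, hM.1, rfl⟩, ?_⟩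
  rintro m ⟨N, hN, rfl⟩
  exact hM.2 N hN

theorem IsMatching.injOn_fst {G : BipartiteGraph V W} {M : Finset (V × W)} (hM : G.IsMatching M) :
    Set.InjOn Prod.fst (M : Set (V × W)) := fun e he e' he' h => hM.2 e he e' he' (Or.inl h)

variable [DecidableEq V]

theorem IsMatching.image_fst_subset {G : BipartiteGraph V W} {M : Finset (V × W)}
    (hM : G.IsMatching M) : M.image Prod.fst ⊆ G.left := by
  intro r hr
  obtain ⟨e, he, rfl⟩ := Finset.mem_image.1 hr
  exact (Finset.mem_product.1 (G.edges_subset (hM.1 he))).1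

theorem IsMatching.card_le {G : BipartiteGraph V W} {M : Finset (V × W)} (hM : G.IsMatching M) :
    M.card ≤ G.left.card := by
  rw [← Finset.card_image_of_injOn hM.injOn_fst]
  exact Finset.card_le_card hM.image_fst_subset

variable [DecidableEq W]

/-- A matching covering all left vertices is given by a function. -/
theorem IsMatching.exists_eq_image [Nonempty W] {G : BipartiteGraph V W} {M : Finset (V × W)}
    (hM : G.IsMatching M) (hcard : G.left.card ≤ M.card) :
    ∃ g : V → W, M = G.left.image (fun r => (r, g r)) ∧ Set.InjOn g G.left ∧
      ∀ r ∈ G.left, (r, g r) ∈ G.edges := by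
  have himg : M.image Prod.fst = G.left :=
    Finset.eq_of_subset_of_card_le hM.image_fst_subset
      (by rwa [Finset.card_image_of_injOn hM.injOn_fst])
  have hex : ∀ r, ∃ c, r ∈ G.left → (r, c) ∈ M := by
    intro r
    by_cases hr : r ∈ G.left
    · rw [← himg] at hr
      obtain ⟨⟨r', c⟩, he, rfl⟩ := Finset.mem_image.1 hr
      exact ⟨c, fun _ => he⟩
    · exact ⟨Classical.arbitrary W, fun h => absurd h hr⟩
  choose g hg using hex
  refine ⟨g, ?_, ?_, fun r hr => hM.1 (hg r hr)⟩
  · ext ⟨r, c⟩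
    rw [Finset.mem_image]
    constructor
    · intro h
      have hr : r ∈ G.left := himg ▸ Finset.mem_image_of_mem Prod.fst h
      exact ⟨r, hr, hM.2 _ (hg r hr) _ h (Or.inl rfl)⟩
    · rintro ⟨r', hr', h⟩
      rw [← h]
      exact hg r' hr'
  · intro r hr r' hr' h
    exact congrArg Prod.fst (hM.2 _ (hg r hr) _ (hg r' hr') (Or.inr h))

theorem isMaximumMatching_image {G : BipartiteGraph V W} {g : V → W} (hg : Set.InjOn g G.left)
    (hE : ∀ r ∈ G.left, (r, g r) ∈ G.edges) :
    G.IsMaximumMatching (G.left.image fun r => (r, g r)) ∧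
      (G.left.image fun r => (r, g r)).card = G.left.card := by
  have hc : (G.left.image fun r => (r, g r)).card = G.left.card :=
    Finset.card_image_of_injective _ fun r r' h => congrArg Prod.fst h
  refine ⟨⟨⟨?_, ?_⟩, fun N hN => hc ▸ hN.card_le⟩, hc⟩
  · intro e he
    obtain ⟨r, hr, rfl⟩ := Finset.mem_image.1 he
    exact hE r hr
  · intro e he e' he' h
    obtain ⟨r, hr, rfl⟩ := Finset.mem_image.1 he
    obtain ⟨r', hr', rfl⟩ := Finset.mem_image.1 he'
    rcases h with h | h
    · rw [show r = r' from h]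
    · rw [hg hr hr' h]

theorem mem_edges_induce {G : BipartiteGraph V W} {S : Finset V} {T : Finset W} {e : V × W} :
    e ∈ (G.induce S T).edges ↔ e ∈ G.edges ∧ e.1 ∈ S ∧ e.2 ∈ T := by
  simp [induce]

variable [Fintype V]

/-- The perfect matching `f` of `G` consists of perfect matchings of the blocks of a decomposition
without tails; `B r` is the block of the left vertex `r`. -/
structure IsBlockMatching (G : BipartiteGraph V W) {d : ℕ} (Vp : Fin (d + 2) → Finset V)
    (Vm : Fin (d + 2) → Finset W) (f : V → W) (B : V → Fin (d + 2)) : Prop where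
  left_eq : G.left = Finset.univ
  right_eq : ∀ c, c ∈ G.right ↔ ∃ r, f r = c
  injective : Function.Injective f
  edge : ∀ r, (r, f r) ∈ G.edges
  mem_left : ∀ r k, r ∈ Vp k ↔ B r = k
  mem_right : ∀ r k, f r ∈ Vm k ↔ B r = k
  exists_right : ∀ k, ∀ c ∈ Vm k, ∃ r, f r = c
  ne_zero : ∀ r, B r ≠ 0
  ne_last : ∀ r, B r ≠ Fin.last (d + 1)
  triangular : ∀ r s, (r, f s) ∈ G.edges → B r ≤ B s

/-- Let `B r` and `C r` be the blocks of a row and of its partner `f r`. Triangularity gives `B ≤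
C`. Then the rows of the vertical tail have partners in it and the columns of the horizontal tail
have partners in it, which contradicts the strict inequalities unless the tails are empty. In the
other blocks the sizes agree, so `B` and `C` have the same sum and must coincide. -/
theorem IsBlockDecomposition.exists_isBlockMatching {G : BipartiteGraph V W} {d : ℕ}
    {Vp : Fin (d + 2) → Finset V} {Vm : Fin (d + 2) → Finset W}
    (hD : G.IsBlockDecomposition d Vp Vm) (hleft : G.left = Finset.univ) {f : V → W}
    (hf : Function.Injective f) (hright : ∀ c ∈ G.right, ∃ r, f r = c)
    (hE : ∀ r, (r, f r) ∈ G.edges) : ∃ B, G.IsBlockMatching Vp Vm f B := by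
  have hfr : ∀ r, f r ∈ G.right := fun r => (Finset.mem_product.1 (G.edges_subset (hE r))).2
  choose B hB using fun r => (hD.union_left r).1 (hleft ▸ Finset.mem_univ r)
  choose C hC using fun r => (hD.union_right (f r)).1 (hfr r)
  have hBk : ∀ r k, r ∈ Vp k ↔ B r = k := by
    refine fun r k => ⟨fun h => ?_, fun h => h ▸ hB r⟩
    by_contra hn
    exact Finset.disjoint_left.1 (hD.disjoint_left _ _ hn) (hB r) h
  have hCk : ∀ r k, f r ∈ Vm k ↔ C r = k := by
    refine fun r k => ⟨fun h => ?_, fun h => h ▸ hC r⟩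
    by_contra hn
    exact Finset.disjoint_left.1 (hD.disjoint_right _ _ hn) (hC r) h
  have hex : ∀ k, ∀ c ∈ Vm k, ∃ r, f r = c := fun k c hc =>
    hright c ((hD.union_right c).2 ⟨k, hc⟩)
  have hBC : ∀ r, B r ≤ C r := fun r => hD.triangular _ (hE r) _ _ (hB r) (hC r)
  have hVp : ∀ k, Vp k = Finset.univ.filter fun r => B r = k := fun k => by
    ext r
    simp [hBk]
  have hVm : ∀ k, Vm k = (Finset.univ.filter fun r => C r = k).image f := fun k => by
    ext c
    rw [Finset.mem_image]
    constructor
    · intro hc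
      obtain ⟨r, rfl⟩ := hex k c hc
      exact ⟨r, by simpa using (hCk r k).1 hc, rfl⟩
    · rintro ⟨r, hr, rfl⟩
      exact (hCk r k).2 (by simpa using hr)
  have hcp : ∀ k, (Vp k).card = (Finset.univ.filter fun r => B r = k).card := fun k => by
    rw [hVp]
  have hcm : ∀ k, (Vm k).card = (Finset.univ.filter fun r => C r = k).card := fun k => by
    rw [hVm, Finset.card_image_of_injective _ hf]
  have hClast : ∀ r, C r ≠ Fin.last (d + 1) := by
    intro r hr
    have h1 := hD.vertical.2 ⟨f r, (hCk r _).2 hr⟩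
    rw [hcp, hcm] at h1
    refine absurd h1 (not_lt.2 (Finset.card_le_card fun r' hr' => ?_))
    simp only [Finset.mem_filter, Finset.mem_univ, true_and] at hr' ⊢
    exact le_antisymm (Fin.le_last _) (hr' ▸ hBC r')
  have hBlast : ∀ r, B r ≠ Fin.last (d + 1) := fun r hr =>
    hClast r (le_antisymm (Fin.le_last _) (hr ▸ hBC r))
  have hB0 : ∀ r, B r ≠ 0 := by
    intro r hr
    have h1 := hD.horizontal.2 ⟨r, (hBk r _).2 hr⟩
    rw [hcp, hcm] at h1
    refine absurd h1 (not_lt.2 (Finset.card_le_card fun r' hr' => ?_))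
    simp only [Finset.mem_filter, Finset.mem_univ, true_and] at hr' ⊢
    exact le_antisymm (hr' ▸ hBC r') (Fin.zero_le _)
  have hC0 : ∀ r, C r ≠ 0 := fun r hr =>
    hB0 r (le_antisymm (hr ▸ hBC r) (Fin.zero_le _))
  have hcard : ∀ k, (Finset.univ.filter fun r => B r = k).card
      = (Finset.univ.filter fun r => C r = k).card := by
    intro k
    by_cases hk0 : k = 0
    · rw [Finset.filter_false_of_mem fun r _ => hk0 ▸ hB0 r,
        Finset.filter_false_of_mem fun r _ => hk0 ▸ hC0 r]
    · by_cases hkl : k = Fin.last (d + 1)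
      · rw [Finset.filter_false_of_mem fun r _ => hkl ▸ hBlast r,
          Finset.filter_false_of_mem fun r _ => hkl ▸ hClast r]
      · rw [← hcp, ← hcm]
        exact (hD.consistent k hk0 hkl).2.2
  have hsum : ∑ r, (B r : ℕ) = ∑ r, (C r : ℕ) := by
    rw [← Finset.sum_fiberwise' Finset.univ B fun k => (k : ℕ),
      ← Finset.sum_fiberwise' Finset.univ C fun k => (k : ℕ)]
    refine Finset.sum_congr rfl fun k _ => ?_
    rw [Finset.sum_const, Finset.sum_const, hcard]
  have hBCeq : ∀ r, B r = C r := fun r =>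
    Fin.ext ((Finset.sum_eq_sum_iff_of_le fun r _ => Fin.le_def.1 (hBC r)).1 hsum r
      (Finset.mem_univ r))
  refine ⟨B, hleft, fun c => ⟨hright c, ?_⟩, hf, hE, hBk, fun r k => by rw [hCk, hBCeq], hex,
    hB0, hBlast, fun r s h => hD.triangular _ h _ _ (hB r) (hBCeq s ▸ hC s)⟩
  rintro ⟨r, rfl⟩
  exact hfr r

/-- The edge `(r, f s)` lies in a perfect matching of its block. -/
def IsBlockAdmissible (G : BipartiteGraph V W) {κ : Type} (f : V → W) (B : V → κ) (r s : V) :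
    Prop :=
  ∃ g : V → V, g r = s ∧ Set.InjOn g {x | B x = B r} ∧
    ∀ x, B x = B r → B (g x) = B r ∧ (x, f (g x)) ∈ G.edges

/-- A decomposition compatible with a perfect matching is a block decomposition. -/
theorem isBlockDecomposition_of_blocks {G : BipartiteGraph V W} {d : ℕ} {f : V → W}
    {B : V → Fin (d + 2)} (hleft : G.left = Finset.univ) (hright : ∀ c, c ∈ G.right ↔ ∃ r, f r = c)
    (hf : Function.Injective f) (hE : ∀ r, (r, f r) ∈ G.edges) (hB0 : ∀ r, B r ≠ 0)
    (hBlast : ∀ r, B r ≠ Fin.last (d + 1)) (hsurj : ∀ k, k ≠ 0 → k ≠ Fin.last (d + 1) → ∃ r, B r = k)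
    (htri : ∀ r s, (r, f s) ∈ G.edges → B r ≤ B s)
    (hadm : ∀ r s, (r, f s) ∈ G.edges → B r = B s → G.IsBlockAdmissible f B r s) :
    G.IsBlockDecomposition d (fun k => Finset.univ.filter fun r => B r = k)
      fun k => (Finset.univ.filter fun r => B r = k).image f := by
  have hmemR : ∀ s k, f s ∈ (Finset.univ.filter fun r => B r = k).image f ↔ B s = k := by
    intro s k
    rw [Finset.mem_image]
    constructor
    · rintro ⟨r, hr, h⟩
      rw [← hf h]
      simpa using hr
    · intro h
      exact ⟨s, by simpa using h, rfl⟩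
  have hGl : ∀ k, (G.induce (Finset.univ.filter fun r => B r = k)
      ((Finset.univ.filter fun r => B r = k).image f)).left
        = Finset.univ.filter fun r => B r = k := by
    intro k
    simp [induce, hleft]
  have hmax := fun (k : Fin (d + 2)) (g : V → V) (hg : Set.InjOn g {x | B x = k})
      (hgE : ∀ x, B x = k → B (g x) = k ∧ (x, f (g x)) ∈ G.edges) =>
    isMaximumMatching_image (G := G.induce (Finset.univ.filter fun r => B r = k)
      ((Finset.univ.filter fun r => B r = k).image f)) (g := fun x => f (g x)) (by
        intro x hx y hy h
        rw [hGl] at hx hy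
        exact hg (by simpa using hx) (by simpa using hy) (hf h)) (by
        intro x hx
        rw [hGl] at hx
        have hx : B x = k := by simpa using hx
        rw [mem_edges_induce]
        exact ⟨(hgE x hx).2, by simpa using hx, (hmemR _ _).2 (hgE x hx).1⟩)
  have hmt : ∀ k, (G.induce (Finset.univ.filter fun r => B r = k)
      ((Finset.univ.filter fun r => B r = k).image f)).mt
        = (Finset.univ.filter fun r => B r = k).card := by
    intro k
    have := hmax k id (Set.injOn_id _) fun x hx => ⟨hx, hE x⟩
    rw [mt_eq_card this.1, this.2, hGl]
  have hcard : ∀ k, ((Finset.univ.filter fun r => B r = k).image f).card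
      = (Finset.univ.filter fun r => B r = k).card := fun k =>
    Finset.card_image_of_injective _ hf
  refine ⟨fun v => ?_, fun w => ?_, fun k l hkl => ?_, fun k l hkl => ?_, fun k hk0 hkl => ?_,
    ⟨hmt 0, ?_⟩, ⟨?_, ?_⟩, ?_, ?_⟩
  · simp [hleft]
  · rw [hright]
    constructor
    · rintro ⟨r, rfl⟩
      exact ⟨B r, (hmemR _ _).2 rfl⟩
    · rintro ⟨k, hk⟩
      obtain ⟨r, -, hr⟩ := Finset.mem_image.1 hk
      exact ⟨r, hr⟩
  · rw [Finset.disjoint_left]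
    intro r hr hr'
    simp only [Finset.mem_filter, Finset.mem_univ, true_and] at hr hr'
    exact hkl (hr.symm.trans hr')
  · rw [Finset.disjoint_left]
    intro c hc hc'
    obtain ⟨r, -, rfl⟩ := Finset.mem_image.1 hc
    exact hkl (((hmemR _ _).1 hc).symm.trans ((hmemR _ _).1 hc'))
  · obtain ⟨r, hr⟩ := hsurj k hk0 hkl
    exact ⟨⟨r, by simpa using hr⟩, hmt k, (hcard k).symm⟩
  · rintro ⟨r, hr⟩
    exact absurd (by simpa using hr) (hB0 r)
  · rw [hmt, hcard]
  · rintro ⟨c, hc⟩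
    obtain ⟨r, hr, -⟩ := Finset.mem_image.1 hc
    exact absurd (by simpa using hr) (hBlast r)
  · rintro k ⟨r, c⟩ he
    obtain ⟨h1, h2, h3⟩ := mem_edges_induce.1 he
    obtain ⟨s, -, rfl⟩ := Finset.mem_image.1 h3
    have h2 : B r = k := by simpa using h2
    have h3 : B s = k := (hmemR _ _).1 h3
    obtain ⟨g, hgs, hgi, hgE⟩ := hadm r s h1 (h2.trans h3.symm)
    rw [h2] at hgi hgE
    refine ⟨_, (hmax k g hgi hgE).1, ?_⟩
    rw [hGl, Finset.mem_image]
    exact ⟨r, by simpa using h2, by rw [hgs]⟩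
  · rintro ⟨r, c⟩ he k l hr hc
    obtain ⟨s, -, rfl⟩ := Finset.mem_image.1 hc
    have hr : B r = k := by simpa using hr
    have hs : B s = l := (hmemR _ _).1 hc
    rw [← hr, ← hs]
    exact htri r s he

namespace IsBlockMatching

variable {G : BipartiteGraph V W} {d : ℕ} {Vp : Fin (d + 2) → Finset V}
  {Vm : Fin (d + 2) → Finset W} {f : V → W} {B : V → Fin (d + 2)}

theorem left_induce (h : G.IsBlockMatching Vp Vm f B) (k : Fin (d + 2)) :
    (G.induce (Vp k) (Vm k)).left = Vp k := by
  simp [induce, h.left_eq]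

theorem isMaximumMatching_block (h : G.IsBlockMatching Vp Vm f B) {k : Fin (d + 2)} {g : V → V}
    (hg : Set.InjOn g {x | B x = k})
    (hgE : ∀ x, B x = k → B (g x) = k ∧ (x, f (g x)) ∈ G.edges) :
    (G.induce (Vp k) (Vm k)).IsMaximumMatching ((Vp k).image fun x => (x, f (g x))) ∧
      ((Vp k).image fun x => (x, f (g x))).card = (Vp k).card := by
  have := isMaximumMatching_image (G := G.induce (Vp k) (Vm k)) (g := fun x => f (g x)) (by
    rw [h.left_induce]
    intro x hx y hy hxy
    exact hg ((h.mem_left _ _).1 hx) ((h.mem_left _ _).1 hy) (h.injective hxy)) (by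
    rw [h.left_induce]
    intro x hx
    have hx' := (h.mem_left _ _).1 hx
    exact mem_edges_induce.2 ⟨(hgE x hx').2, hx, (h.mem_right _ _).2 (hgE x hx').1⟩)
  rwa [h.left_induce] at this

theorem exists_function_of_isMaximumMatching_block [Nonempty V] (h : G.IsBlockMatching Vp Vm f B)
    {k : Fin (d + 2)} {M : Finset (V × W)}
    (hM : (G.induce (Vp k) (Vm k)).IsMaximumMatching M) :
    ∃ g : V → V, M = (Vp k).image (fun x => (x, f (g x))) ∧ Set.InjOn g {x | B x = k} ∧
      ∀ x, B x = k → B (g x) = k ∧ (x, f (g x)) ∈ G.edges := by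
  have hid := h.isMaximumMatching_block (k := k) (Set.injOn_id _) fun x hx => ⟨hx, h.edge x⟩
  have : Nonempty W := ⟨f (Classical.arbitrary V)⟩
  obtain ⟨g₀, hMg, hinj, hE⟩ := hM.1.exists_eq_image (by
    rw [h.left_induce, ← hid.2]
    exact hM.2 _ hid.1.1)
  rw [h.left_induce] at hMg hinj hE
  have hex : ∀ x, ∃ y, B x = k → f y = g₀ x := by
    intro x
    by_cases hx : B x = k
    · obtain ⟨y, hy⟩ := h.exists_right k (g₀ x)
        (mem_edges_induce.1 (hE x ((h.mem_left _ _).2 hx))).2.2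
      exact ⟨y, fun _ => hy⟩
    · exact ⟨x, fun h => absurd h hx⟩
  choose g hg using hex
  refine ⟨g, ?_, ?_, fun x hx => ?_⟩
  · rw [hMg]
    refine Finset.image_congr fun x hx => ?_
    rw [hg x ((h.mem_left _ _).1 hx)]
  · intro x hx y hy hxy
    apply hinj ((h.mem_left _ _).2 hx) ((h.mem_left _ _).2 hy)
    rw [← hg x hx, ← hg y hy, hxy]
  · have h1 := mem_edges_induce.1 (hE x ((h.mem_left _ _).2 hx))
    rw [← hg x hx] at h1
    exact ⟨(h.mem_right _ _).1 h1.2.2, h1.1⟩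

theorem isBlockAdmissible (h : G.IsBlockMatching Vp Vm f B)
    (hD : G.IsBlockDecomposition d Vp Vm) {r s : V} (hrs : (r, f s) ∈ G.edges)
    (hB : B r = B s) : G.IsBlockAdmissible f B r s := by
  have : Nonempty V := ⟨r⟩
  obtain ⟨M, hM, hmem⟩ := hD.admissible (B r) (r, f s) (mem_edges_induce.2
    ⟨hrs, (h.mem_left _ _).2 rfl, (h.mem_right _ _).2 hB.symm⟩)
  obtain ⟨g, rfl, hg, hgE⟩ := h.exists_function_of_isMaximumMatching_block hM
  refine ⟨g, ?_, hg, hgE⟩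
  obtain ⟨x, -, hx⟩ := Finset.mem_image.1 hmem
  have h1 : x = r := congrArg Prod.fst hx
  have h2 : f (g x) = f s := congrArg Prod.snd hx
  rw [← h1]
  exact h.injective h2

/-- The blocks of a DM-decomposition are connected. -/
theorem eq_block_of_closed (h : G.IsBlockMatching Vp Vm f B) (hD : G.IsDMDecomposition d Vp Vm)
    {k : Fin (d + 2)} {S : Set V} (hSk : ∀ r ∈ S, B r = k) (hS : S.Nonempty)
    (hcl : ∀ r s, B r = k → B s = k → (r, f s) ∈ G.edges → (r ∈ S ↔ s ∈ S)) :
    ∀ r, B r = k → r ∈ S := by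
  classical
  by_contra hn
  push Not at hn
  obtain ⟨r₁, hr₁, hr₁S⟩ := hn
  obtain ⟨r₀, hr₀⟩ := hS
  -- A proper closed part `S` of block `k` would allow a finer decomposition: `S` keeps the index
  -- `k`, the rest of the block gets `k + 1`, and all later blocks move up by one. This contradicts
  -- the maximality of `d`.
  let B' : V → Fin (d + 1 + 2) := fun r =>
    ⟨if B r < k ∨ r ∈ S then (B r : ℕ) else B r + 1, by split_ifs <;> omega⟩
  have hval : ∀ r, (B' r : ℕ) = if B r < k ∨ r ∈ S then (B r : ℕ) else B r + 1 := fun r => rfl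
  have hB0 : ∀ r, (B r : ℕ) ≠ 0 := fun r h' => h.ne_zero r (Fin.ext h')
  have hBl : ∀ r, (B r : ℕ) ≠ d + 1 := fun r h' => h.ne_last r (Fin.ext h')
  have hSk' : ∀ r ∈ S, (B r : ℕ) = k := fun r hr => congrArg Fin.val (hSk r hr)
  have hlt : ∀ r s, B r < B s → B' r < B' s := by
    intro r s hrs
    rw [Fin.lt_def, hval, hval]
    rw [Fin.lt_def] at hrs
    have h1 := hSk' s
    have h2 := hSk' r
    simp only [Fin.lt_def]
    split_ifs with h3 h4 h4
    all_goals try omega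
    rcases h4 with h4 | h4
    · omega
    · have := h1 h4
      omega
  have hBB : ∀ {r s}, B' r = B' s → B r = B s := by
    intro r s hrs
    by_contra hne
    rcases lt_or_gt_of_ne hne with h1 | h1
    · exact (hlt _ _ h1).ne hrs
    · exact (hlt _ _ h1).ne' hrs
  have heq : ∀ r s, B r = B s → (r, f s) ∈ G.edges → B' r = B' s := by
    intro r s hrs hE
    apply Fin.ext
    rw [hval, hval, hrs]
    by_cases hk : B s = k
    · have := hcl r s (hrs.trans hk) hk hE
      simp only [this]
    · have h1 : r ∉ S := fun h' => hk (hrs ▸ hSk r h')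
      have h2 : s ∉ S := fun h' => hk (hSk s h')
      simp [h1, h2]
  have hdec : G.IsBlockDecomposition (d + 1) _ _ := isBlockDecomposition_of_blocks (B := B')
    h.left_eq h.right_eq h.injective h.edge
    (fun r h' => by
      have h1 := congrArg Fin.val h'
      rw [hval] at h1
      have := hB0 r
      simp only [Fin.val_zero] at h1
      split_ifs at h1 <;> omega)
    (fun r h' => by
      have h1 := congrArg Fin.val h'
      rw [hval] at h1
      have := hBl r
      simp only [Fin.val_last] at h1
      have := (B r).isLt
      split_ifs at h1 <;> omega)
    (fun m hm0 hml => by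
      have hm0 : (m : ℕ) ≠ 0 := fun h' => hm0 (Fin.ext h')
      have hml : (m : ℕ) ≠ d + 1 + 1 := fun h' => hml (Fin.ext h')
      have hmlt := m.isLt
      have hattain : ∀ l : ℕ, l ≠ 0 → l < d + 1 → ∃ r, (B r : ℕ) = l := by
        intro l h0 hl
        obtain ⟨⟨r, hr⟩, -⟩ := hD.1.consistent ⟨l, by omega⟩ (fun h' => h0 (congrArg Fin.val h'))
          (fun h' => by
            have := congrArg Fin.val h'
            simp only [Fin.val_last] at this
            omega)
        exact ⟨r, congrArg Fin.val ((h.mem_left _ _).1 hr)⟩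
      have hk0 := hB0 r₀
      have hkl := hBl r₀
      rw [hSk r₀ hr₀] at hk0 hkl
      have hklt := k.isLt
      rcases lt_trichotomy (m : ℕ) k with h1 | h1 | h1
      · obtain ⟨r, hr⟩ := hattain m hm0 (by omega)
        refine ⟨r, Fin.ext ?_⟩
        rw [hval, if_pos (Or.inl (by rw [Fin.lt_def]; omega)), hr]
      · refine ⟨r₀, Fin.ext ?_⟩
        rw [hval, if_pos (Or.inr hr₀), hSk' r₀ hr₀, h1]
      · by_cases h2 : (m : ℕ) = k + 1
        · refine ⟨r₁, Fin.ext ?_⟩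
          rw [hval, if_neg (by rw [hr₁]; simp [hr₁S]), hr₁, h2]
        · obtain ⟨r, hr⟩ := hattain (m - 1) (by omega) (by omega)
          refine ⟨r, Fin.ext ?_⟩
          rw [hval, if_neg, hr]
          · omega
          · rintro (h' | h')
            · rw [Fin.lt_def] at h'
              omega
            · have := hSk' r h'
              omega)
    (fun r s hE => by
      rcases (h.triangular r s hE).lt_or_eq with h1 | h1
      · exact (hlt _ _ h1).le
      · exact (heq _ _ h1 hE).le)
    (fun r s hE hrs => by
      obtain ⟨g, hgs, hgi, hgE⟩ := h.isBlockAdmissible hD.1 hE (hBB hrs)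
      refine ⟨g, hgs, hgi.mono fun x hx => hBB hx, fun x hx => ?_⟩
      obtain ⟨h1, h2⟩ := hgE x (hBB hx)
      exact ⟨(heq x (g x) ((hBB hx).trans h1.symm) h2).symm.trans hx, h2⟩)
  have := hD.2 _ _ _ hdec
  omega

end IsBlockMatching

end BipartiteGraph

/-! ### Matchings of an interval of blocks -/

namespace BipartiteGraph.IsBlockMatching

variable {V W : Type} [Fintype V] {G : BipartiteGraph V W} {d : ℕ} {Vp : Fin (d + 2) → Finset V}
  {Vm : Fin (d + 2) → Finset W} {f : V → W} {B : V → Fin (d + 2)}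

/-- On a finite set a permutation that maps a subset into itself maps it onto itself. -/
theorem of_apply_of_invariant (π : Equiv.Perm V) (p : V → Prop) (hp : ∀ x, p x → p (π x))
    {x : V} (hx : p (π x)) : p x := by
  have := Equiv.Perm.perm_symm_mapsTo_of_mapsTo π (s := {x | p x}) (fun x hx => hp x hx) hx
  simpa using this

/-- Otherwise the blocks from `B (π i)` on do not contain `i`, so by triangularity `π` preserves
them; as they contain `π i`, they would contain `i`. -/
theorem block_le_of_perm (h : G.IsBlockMatching Vp Vm f B) {i : V} {π : Equiv.Perm V}
    (hπ : ∀ r, r ≠ i → (r, f (π r)) ∈ G.edges) : B (π i) ≤ B i := by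
  by_contra hn
  have := of_apply_of_invariant π (fun r => B (π i) ≤ B r) (fun x hx => by
    have hxi : x ≠ i := by
      rintro rfl
      exact hn hx
    exact le_trans hx (h.triangular _ _ (hπ x hxi))) (x := i) le_rfl
  exact hn this

theorem apply_block_le_of_perm (h : G.IsBlockMatching Vp Vm f B) {i : V} {π : Equiv.Perm V}
    (hπ : ∀ r, r ≠ i → (r, f (π r)) ∈ G.edges) {x : V} (hx : B x ≤ B i) : B (π x) ≤ B i := by
  by_contra hn
  have := of_apply_of_invariant π (fun r => B i < B r) (fun x hx => by
    have hxi : x ≠ i := by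
      rintro rfl
      exact lt_irrefl _ hx
    exact lt_of_lt_of_le hx (h.triangular _ _ (hπ x hxi))) (x := x) (not_le.1 hn)
  exact absurd hx (not_le.2 this)

variable [DecidableEq V]

/-- An injective map that is defined away from one point extends to a permutation. -/
theorem exists_perm_extending {ρ : V → V} {i : V}
    (hρ : ∀ x y, x ≠ i → y ≠ i → ρ x = ρ y → x = y) :
    ∃ π : Equiv.Perm V, ∀ x, x ≠ i → π x = ρ x := by
  obtain ⟨s, hs⟩ : ∃ s, s ∉ (Finset.univ.erase i).image ρ := by
    by_contra hn
    push Not at hn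
    have h1 := Finset.card_image_le (s := Finset.univ.erase i) (f := ρ)
    rw [Finset.eq_univ_of_forall hn, Finset.card_erase_of_mem (Finset.mem_univ i),
      Finset.card_univ] at h1
    have : 0 < Fintype.card V := Fintype.card_pos_iff.2 ⟨i⟩
    omega
  have hs' : ∀ x, x ≠ i → ρ x ≠ s := fun x hx h' =>
    hs (Finset.mem_image.2 ⟨x, by simpa using hx, h'⟩)
  have hinj : Function.Injective (Function.update ρ i s) := by
    intro x y hxy
    by_cases hx : x = i <;> by_cases hy : y = i
    · rw [hx, hy]
    · rw [hx, Function.update_self, Function.update_of_ne hy] at hxy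
      exact absurd hxy.symm (hs' y hy)
    · rw [hy, Function.update_self, Function.update_of_ne hx] at hxy
      exact absurd hxy (hs' x hx)
    · rw [Function.update_of_ne hx, Function.update_of_ne hy] at hxy
      exact hρ x y hx hy hxy
  refine ⟨Equiv.ofBijective _ (Finite.injective_iff_bijective.1 hinj), fun x hx => ?_⟩
  rw [Equiv.ofBijective_apply, Function.update_of_ne hx]

variable [DecidableEq W]

/-- The interval of blocks from `k` to the block of `i`, without `i`, has a maximum matching that
does not match the block `k` to itself iff `i` and some column of the block `k` are the vertices
missed by a matching of `G`. -/
theorem minWeight_interval_lt_iff (h : G.IsBlockMatching Vp Vm f B) {i : V} {k : Fin (d + 2)}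
    (hk : k ≤ B i) :
    (G.induce (((Finset.Icc k (B i)).biUnion Vp).erase i)
      ((Finset.Icc k (B i)).biUnion Vm)).minWeightMaximumMatching
        (fun e => if e ∈ (G.induce (Vp k) (Vm k)).edges then 1 else 0) < (Vp k).card ↔
      ∃ π : Equiv.Perm V, B (π i) = k ∧ ∀ r, r ≠ i → (r, f (π r)) ∈ G.edges := by
  set J := G.induce (((Finset.Icc k (B i)).biUnion Vp).erase i)
      ((Finset.Icc k (B i)).biUnion Vm) with hJ
  have hmemJ : ∀ r, r ∈ J.left ↔ r ≠ i ∧ k ≤ B r ∧ B r ≤ B i := by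
    intro r
    simp [hJ, induce, h.left_eq, h.mem_left]
  have hmemR : ∀ r, f r ∈ (Finset.Icc k (B i)).biUnion Vm ↔ k ≤ B r ∧ B r ≤ B i := by
    intro r
    simp [h.mem_right]
  have hedge : ∀ {x y}, x ∈ J.left → k ≤ B y → B y ≤ B i → (x, f y) ∈ G.edges →
      (x, f y) ∈ J.edges := by
    intro x y hx hy hy' hE
    obtain ⟨h1, h2, h3⟩ := (hmemJ x).1 hx
    refine mem_edges_induce.2 ⟨hE, ?_, (hmemR y).2 ⟨hy, hy'⟩⟩
    simp [h.mem_left, h1, h2, h3]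
  have hblock : ∀ x y, (x, f y) ∈ (G.induce (Vp k) (Vm k)).edges ↔
      (x, f y) ∈ G.edges ∧ B x = k ∧ B y = k := by
    intro x y
    rw [mem_edges_induce, h.mem_left, h.mem_right]
  constructor
  · intro hlt
    obtain ⟨M, hM, hw⟩ := Nat.sInf_mem (s := {m | ∃ M, J.IsMaximumMatching M ∧
        m = ∑ e ∈ M, if e ∈ (G.induce (Vp k) (Vm k)).edges then 1 else 0}) (by
      obtain ⟨M, hM⟩ := J.exists_isMaximumMatching
      exact ⟨_, M, hM, rfl⟩)
    change J.minWeightMaximumMatching _ = _ at hw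
    rw [hw] at hlt
    -- The restriction of `f` covers all rows of `J`, so every maximum matching does.
    have hdiag := isMaximumMatching_image (G := J) (g := f) (h.injective.injOn) (fun r hr =>
      hedge hr ((hmemJ r).1 hr).2.1 ((hmemJ r).1 hr).2.2 (h.edge r))
    have : Nonempty W := ⟨f i⟩
    obtain ⟨g, rfl, hinj, hE⟩ := hM.1.exists_eq_image (by
      rw [← hdiag.2]
      exact hM.2 _ hdiag.1.1)
    -- Outside the interval the matching is continued by `f`; in the row indexing this is the
    -- identity.
    have hex : ∀ x, ∃ y, (x ∈ J.left → f y = g x) ∧ (x ∉ J.left → y = x) := by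
      intro x
      by_cases hx : x ∈ J.left
      · obtain ⟨k', -, h2⟩ := Finset.mem_biUnion.1 (mem_edges_induce.1 (hE x hx)).2.2
        obtain ⟨y, hy⟩ := h.exists_right _ _ h2
        exact ⟨y, fun _ => hy, fun h' => absurd hx h'⟩
      · exact ⟨x, fun h' => absurd h' hx, fun _ => rfl⟩
    choose ρ hρ₁ hρ₂ using hex
    have hρB : ∀ x ∈ J.left, (k ≤ B (ρ x) ∧ B (ρ x) ≤ B i) ∧ (x, f (ρ x)) ∈ G.edges := by
      intro x hx
      have h1 := mem_edges_induce.1 (hE x hx)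
      rw [← hρ₁ x hx] at h1
      exact ⟨(hmemR _).1 h1.2.2, h1.1⟩
    have hnotJ : ∀ x, x ≠ i → x ∉ J.left → ¬ (k ≤ B x ∧ B x ≤ B i) := fun x hx hxJ h' =>
      hxJ ((hmemJ x).2 ⟨hx, h'⟩)
    obtain ⟨π, hπ⟩ := exists_perm_extending (ρ := ρ) (i := i) (by
      intro x y hx hy hxy
      by_cases hxJ : x ∈ J.left <;> by_cases hyJ : y ∈ J.left
      · apply hinj hxJ hyJ
        rw [← hρ₁ x hxJ, ← hρ₁ y hyJ, hxy]
      · rw [hρ₂ y hyJ] at hxy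
        exact absurd (hxy ▸ (hρB x hxJ).1) (hnotJ y hy hyJ)
      · rw [hρ₂ x hxJ] at hxy
        exact absurd (hxy ▸ (hρB y hyJ).1) (hnotJ x hx hxJ)
      · rwa [hρ₂ x hxJ, hρ₂ y hyJ] at hxy)
    refine ⟨π, ?_, fun r hr => ?_⟩
    · by_contra hne
      apply absurd hlt
      rw [not_lt, Finset.sum_image fun x _ y _ hxy => congrArg Prod.fst hxy]
      rw [← Finset.card_filter]
      -- If the missed column is not in block `k`, every column of that block is matched with a row
      -- of the interval. By triangularity this row lies in block `k` too, so the weight is at least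
      -- the size of the block.
      have hsub : Vp k ⊆ (J.left.filter fun x => (x, g x) ∈ (G.induce (Vp k) (Vm k)).edges).image
          π := by
        intro t ht
        rw [h.mem_left] at ht
        have hti : π.symm t ≠ i := by
          intro h'
          rw [← h', π.apply_symm_apply] at hne
          exact hne ht
        have hπt : ρ (π.symm t) = t := by rw [← hπ _ hti, π.apply_symm_apply]
        have htJ : π.symm t ∈ J.left := by
          by_contra hn
          have h1 := hρ₂ _ hn
          rw [hπt] at h1
          apply hnotJ _ hti hn
          rw [← h1, ht]
          exact ⟨le_rfl, hk⟩
        rw [Finset.mem_image]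
        refine ⟨π.symm t, Finset.mem_filter.2 ⟨htJ, ?_⟩, π.apply_symm_apply t⟩
        rw [← hρ₁ _ htJ, hπt, hblock]
        have hE' := (hρB _ htJ).2
        rw [hπt] at hE'
        exact ⟨hE', le_antisymm (ht ▸ h.triangular _ _ hE') ((hmemJ _).1 htJ).2.1, ht⟩
      exact (Finset.card_le_card hsub).trans Finset.card_image_le
    · rw [hπ r hr]
      by_cases hrJ : r ∈ J.left
      · exact (hρB r hrJ).2
      · rw [hρ₂ r hrJ]
        exact h.edge r
  · rintro ⟨π, hπi, hπE⟩
    have hmax := isMaximumMatching_image (G := J) (g := fun x => f (π x))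
      ((h.injective.comp π.injective).injOn) (fun x hx => by
        obtain ⟨h1, h2, h3⟩ := (hmemJ x).1 hx
        exact hedge hx (h2.trans (h.triangular _ _ (hπE x h1)))
          (h.apply_block_le_of_perm hπE h3) (hπE x h1))
    refine lt_of_le_of_lt (Nat.sInf_le ⟨_, hmax.1, rfl⟩) ?_
    rw [Finset.sum_image fun x _ y _ hxy => congrArg Prod.fst hxy, ← Finset.card_filter,
      ← Finset.card_image_of_injective _ π.injective]
    apply Finset.card_lt_card
    -- The edges of weight 1 end in distinct columns of block `k`, and the column `π i` is not among
    -- them.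
    rw [Finset.ssubset_iff_of_subset]
    · refine ⟨π i, (h.mem_left _ _).2 hπi, fun hn => ?_⟩
      obtain ⟨x, hx, hxi⟩ := Finset.mem_image.1 hn
      exact ((hmemJ x).1 (Finset.mem_filter.1 hx).1).1 (π.injective hxi)
    · intro y hy
      obtain ⟨x, hx, rfl⟩ := Finset.mem_image.1 hy
      exact (h.mem_left _ _).2 ((hblock _ _).1 (Finset.mem_filter.1 hx).2).2.2

end BipartiteGraph.IsBlockMatching

/-! ### The square pencil of a structured pair without a column -/

section Square

variable {n : ℕ} {H : StructuredMatrix (Fin n) (Fin (n + 1))} {f : Fin n → Fin (n + 1)}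

/-- The parameter of `H` at the row `r` and the column `f s`. -/
def squareParameter (H : StructuredMatrix (Fin n) (Fin (n + 1))) (f : Fin n → Fin (n + 1))
    (r s : Fin n) : Option {e : Fin n × Fin (n + 1) // H e.1 e.2 = true} :=
  if h : H r (f s) = true then some ⟨(r, f s), h⟩ else none

/-- The position `(r, f s)` carries a `λ`. -/
def SquareLambda (f : Fin n → Fin (n + 1)) (r s : Fin n) : Prop := f s = r.castSucc

instance (f : Fin n → Fin (n + 1)) (r s : Fin n) : Decidable (SquareLambda f r s) :=
  inferInstanceAs (Decidable (f s = r.castSucc))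

theorem exists_squareParameter_iff {r s : Fin n} :
    (∃ t, squareParameter H f r s = some t) ↔ H r (f s) = true := by
  unfold squareParameter
  split_ifs with h <;> simp [h]

theorem independentEntries_squareParameter (hf : Function.Injective f) :
    IndependentEntries (squareParameter H f) := by
  intro r s r' s' t h h'
  unfold squareParameter at h h'
  split_ifs at h h' with h1 h2
  have := (Option.some.inj h).trans (Option.some.inj h').symm
  have := congrArg Subtype.val this
  exact ⟨congrArg Prod.fst this, hf (congrArg Prod.snd this)⟩

theorem rowFunctional_squareLambda (hf : Function.Injective f) :
    RowFunctional (lambdaEntries (SquareLambda f)) := by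
  intro r s s' h h'
  rw [lambdaEntries_ne_zero] at h h'
  exact hf (Eq.trans h (Eq.symm h'))

theorem squareLambda_left_unique {r r' s : Fin n} (h : SquareLambda f r s)
    (h' : SquareLambda f r' s) : r = r' :=
  Fin.castSucc_injective n (Eq.trans (Eq.symm h) h')

theorem isEntry_square_iff {j : Fin (n + 1)} (hj : ∀ s, f s ≠ j) {r s : Fin n} :
    IsEntry (squareParameter H f) (SquareLambda f) r s ↔
      (r, f s) ∈ (pencilGraphDelete H j).edges := by
  rw [IsEntry, exists_squareParameter_iff, mem_edges_pencilGraphDelete, SquareLambda]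
  simp only [ne_eq, hj s, not_false_eq_true, and_true]
  exact or_comm

theorem pencilValue_square_apply (θ : ParameterSpace H) (z : ℂ) (r s : Fin n) :
    pencilValue (squareParameter H f) (SquareLambda f) θ z r s
      = realizationOf H θ r (f s) - if f s = r.castSucc then z else 0 := by
  have h1 : (lambdaEntries (SquareLambda f) r s).eval z = -if f s = r.castSucc then z else 0 := by
    unfold lambdaEntries
    by_cases h : SquareLambda f r s
    · rw [if_pos h, if_pos (show f s = r.castSucc from h), Polynomial.eval_neg, Polynomial.eval_X]
    · rw [if_neg h, if_neg (show ¬ f s = r.castSucc from h), Polynomial.eval_zero, neg_zero]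
  rw [pencilValue, Matrix.of_apply, h1, sub_eq_add_neg]
  congr 1
  unfold squareParameter realizationOf
  split_ifs <;> rfl

section Block

variable {κ : Type} (B : Fin n → κ) (k : κ)

/-- The parameters of the diagonal block `k`. -/
def blockParameter (H : StructuredMatrix (Fin n) (Fin (n + 1))) (f : Fin n → Fin (n + 1))
    (r s : {r // B r = k}) : Option {e : Fin n × Fin (n + 1) // H e.1 e.2 = true} :=
  squareParameter H f r s

/-- The positions of `λ` in the diagonal block `k`. -/
def BlockLambda (f : Fin n → Fin (n + 1)) (r s : {r // B r = k}) : Prop := SquareLambda f r s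

instance (f : Fin n → Fin (n + 1)) (r s : {r // B r = k}) : Decidable (BlockLambda B k f r s) :=
  inferInstanceAs (Decidable (SquareLambda f r s))

theorem independentEntries_blockParameter (hf : Function.Injective f) :
    IndependentEntries (blockParameter B k H f) := by
  intro r s r' s' t h h'
  obtain ⟨h1, h2⟩ := independentEntries_squareParameter hf _ _ _ _ _ h h'
  exact ⟨Subtype.ext h1, Subtype.ext h2⟩

theorem rowFunctional_blockLambda (hf : Function.Injective f) :
    RowFunctional (lambdaEntries (BlockLambda B k f)) := by
  intro r s s' h h'
  rw [lambdaEntries_ne_zero] at h h'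
  exact Subtype.ext (hf (Eq.trans h (Eq.symm h')))

theorem isEntry_block_iff {j : Fin (n + 1)} (hj : ∀ s, f s ≠ j) {r s : {r // B r = k}} :
    IsEntry (blockParameter B k H f) (BlockLambda B k f) r s ↔
      (r.1, f s) ∈ (pencilGraphDelete H j).edges :=
  isEntry_square_iff hj

theorem eval_det_block [DecidableEq κ] (θ : ParameterSpace H) (z : ℂ) :
    ((parametricPencil (blockParameter B k H f)
      (lambdaEntries (BlockLambda B k f))).det.map (MvPolynomial.eval θ)).eval z
      = ((pencilValue (squareParameter H f) (SquareLambda f) θ z).toSquareBlock B k).det := by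
  rw [eval_det_parametricPencil]
  rfl

end Block

variable {d : ℕ} {Vp : Fin (d + 2) → Finset (Fin n)} {Vm : Fin (d + 2) → Finset (Fin (n + 1))}
  {B : Fin n → Fin (d + 2)} {j : Fin (n + 1)} {k : Fin (d + 2)}

theorem exists_block_perm (hj : ∀ s, f s ≠ j) {g : Fin n → Fin n} (hg : Set.InjOn g {x | B x = k})
    (hgE : ∀ x, B x = k → B (g x) = k ∧ (x, f (g x)) ∈ (pencilGraphDelete H j).edges) :
    ∃ π : Equiv.Perm {r // B r = k}, (∀ r, (π r : Fin n) = g r) ∧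
      ∀ r, IsEntry (blockParameter B k H f) (BlockLambda B k f) r (π r) := by
  let ρ : {r // B r = k} → {r // B r = k} := fun r => ⟨g r, (hgE r r.2).1⟩
  have hρ : Function.Injective ρ := fun r s h =>
    Subtype.ext (hg r.2 s.2 (congrArg Subtype.val h))
  refine ⟨Equiv.ofBijective ρ (Finite.injective_iff_bijective.1 hρ), fun r => rfl, fun r => ?_⟩
  rw [isEntry_block_iff B k hj]
  exact (hgE r r.2).2

theorem block_isEntry_admissible (hB : (pencilGraphDelete H j).IsBlockMatching Vp Vm f B)
    (hD : (pencilGraphDelete H j).IsBlockDecomposition d Vp Vm) (hj : ∀ s, f s ≠ j)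
    (r s : {r // B r = k})
    (hrs : IsEntry (blockParameter B k H f) (BlockLambda B k f) r s) :
    ∃ π : Equiv.Perm {r // B r = k}, π r = s ∧
      ∀ r', IsEntry (blockParameter B k H f) (BlockLambda B k f) r' (π r') := by
  rw [isEntry_block_iff B k hj] at hrs
  obtain ⟨g, hgs, hg, hgE⟩ := hB.isBlockAdmissible hD hrs (r.2.trans s.2.symm)
  rw [r.2] at hg hgE
  obtain ⟨π, hπ, hE⟩ := exists_block_perm hj hg hgE
  exact ⟨π, Subtype.ext ((hπ r).trans hgs), hE⟩

/-- The numbers of `λ`-edges in the maximum matchings of the block `k`. -/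
theorem exists_isMaximumMatching_lambda_iff
    (hB : (pencilGraphDelete H j).IsBlockMatching Vp Vm f B) (hj : ∀ s, f s ≠ j) (m : ℕ)
    (i : Fin n) :
    (∃ M, ((pencilGraphDelete H j).induce (Vp k) (Vm k)).IsMaximumMatching M ∧
      m = (M.filter IsLambdaEdge).card) ↔
    ∃ π : Equiv.Perm {r // B r = k},
      (∀ r, IsEntry (blockParameter B k H f) (BlockLambda B k f) r (π r)) ∧
        m = (Finset.univ.filter fun r => BlockLambda B k f r (π r)).card := by
  have hcount : ∀ (g : Fin n → Fin n) (π : Equiv.Perm {r // B r = k}),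
      (∀ r, (π r : Fin n) = g r) →
      (((Vp k).image fun x => (x, f (g x))).filter IsLambdaEdge).card
        = (Finset.univ.filter fun r => BlockLambda B k f r (π r)).card := by
    intro g π hπ
    symm
    refine Finset.card_bij (fun r _ => (r.1, f (g r.1))) ?_ ?_ ?_
    · intro r hr
      have hr : BlockLambda B k f r (π r) := by simpa using hr
      refine Finset.mem_filter.2 ⟨Finset.mem_image.2 ⟨r, (hB.mem_left _ _).2 r.2, rfl⟩, ?_⟩
      rw [← hπ]
      exact hr
    · intro r _ r' _ h
      exact Subtype.ext (congrArg Prod.fst h)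
    · intro e he
      obtain ⟨h1, h2⟩ := Finset.mem_filter.1 he
      obtain ⟨x, hx, rfl⟩ := Finset.mem_image.1 h1
      refine ⟨⟨x, (hB.mem_left _ _).1 hx⟩, ?_, rfl⟩
      have := hπ ⟨x, (hB.mem_left _ _).1 hx⟩
      have h2 : f (g x) = x.castSucc := h2
      rw [← this] at h2
      exact Finset.mem_filter.2 ⟨Finset.mem_univ _, h2⟩
  constructor
  · rintro ⟨M, hM, rfl⟩
    have : Nonempty (Fin n) := ⟨i⟩
    obtain ⟨g, rfl, hg, hgE⟩ := hB.exists_function_of_isMaximumMatching_block hM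
    obtain ⟨π, hπ, hE⟩ := exists_block_perm hj hg hgE
    exact ⟨π, hE, hcount g π hπ⟩
  · rintro ⟨π, hπ, rfl⟩
    let g : Fin n → Fin n := fun x => if h : B x = k then π ⟨x, h⟩ else x
    have hg : ∀ r : {r // B r = k}, (π r : Fin n) = g r := fun r => by simp [g, r.2]
    refine ⟨_, (hB.isMaximumMatching_block (g := g) ?_ ?_).1, (hcount g π hg).symm⟩
    · intro x hx y hy hxy
      have h1 := hg ⟨x, hx⟩
      have h2 := hg ⟨y, hy⟩
      have := π.injective (Subtype.ext (h1.trans (hxy.trans h2.symm)))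
      exact congrArg Subtype.val this
    · intro x hx
      rw [← hg ⟨x, hx⟩]
      exact ⟨(π ⟨x, hx⟩).2, (isEntry_block_iff B k hj).1 (hπ ⟨x, hx⟩)⟩

theorem lambda_count_bounds (hB : (pencilGraphDelete H j).IsBlockMatching Vp Vm f B)
    (hj : ∀ s, f s ≠ j) (i : Fin n) {π : Equiv.Perm {r // B r = k}}
    (hπ : ∀ r, IsEntry (blockParameter B k H f) (BlockLambda B k f) r (π r)) :
    gammaMin ((pencilGraphDelete H j).induce (Vp k) (Vm k)) ≤
        (Finset.univ.filter fun r => BlockLambda B k f r (π r)).card ∧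
      (Finset.univ.filter fun r => BlockLambda B k f r (π r)).card ≤
        gammaMax ((pencilGraphDelete H j).induce (Vp k) (Vm k)) := by
  have hmem := (exists_isMaximumMatching_lambda_iff hB hj _ i).2 ⟨π, hπ, rfl⟩
  refine ⟨Nat.sInf_le hmem, le_csSup ⟨Fintype.card {r // B r = k}, ?_⟩ hmem⟩
  rintro m hm
  obtain ⟨π', -, rfl⟩ := (exists_isMaximumMatching_lambda_iff hB hj m i).1 hm
  exact Finset.card_le_univ _

/-- In a block with `γ_nz = 1` the determinant has terms of different degrees in `λ`. -/
theorem exists_terms_of_gammaNonzero (hB : (pencilGraphDelete H j).IsBlockMatching Vp Vm f B)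
    (hD : (pencilGraphDelete H j).IsBlockDecomposition d Vp Vm) (hj : ∀ s, f s ≠ j) (i : Fin n)
    (hγ : GammaNonzero H ((pencilGraphDelete H j).induce (Vp k) (Vm k))) :
    ∃ π T π' T', IsTerm (blockParameter B k H f) (lambdaEntries (BlockLambda B k f)) π T ∧
      IsTerm (blockParameter B k H f) (lambdaEntries (BlockLambda B k f)) π' T' ∧
        T.card ≠ T'.card := by
  classical
  rcases hγ with hγ | ⟨⟨r, c⟩, he, hl, hstar⟩
  · have hne : ∃ m, ∃ M, ((pencilGraphDelete H j).induce (Vp k) (Vm k)).IsMaximumMatching M ∧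
        m = (M.filter IsLambdaEdge).card := by
      obtain ⟨M, hM⟩ := ((pencilGraphDelete H j).induce (Vp k) (Vm k)).exists_isMaximumMatching
      exact ⟨_, M, hM, rfl⟩
    have hmin := (exists_isMaximumMatching_lambda_iff hB hj _ i).1
      (Nat.sInf_mem (s := {m | ∃ M, ((pencilGraphDelete H j).induce (Vp k) (Vm k)).IsMaximumMatching M
        ∧ m = (M.filter IsLambdaEdge).card}) hne)
    have hmax := (exists_isMaximumMatching_lambda_iff hB hj _ i).1
      (Nat.sSup_mem (s := {m | ∃ M, ((pencilGraphDelete H j).induce (Vp k) (Vm k)).IsMaximumMatching M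
        ∧ m = (M.filter IsLambdaEdge).card}) hne (by
          refine ⟨Fintype.card {r // B r = k}, ?_⟩
          rintro m hm
          obtain ⟨π', -, rfl⟩ := (exists_isMaximumMatching_lambda_iff hB hj m i).1 hm
          exact Finset.card_le_univ _))
    obtain ⟨π, hπ, h1⟩ := hmin
    obtain ⟨π', hπ', h2⟩ := hmax
    change gammaMin _ = _ at h1
    change gammaMax _ = _ at h2
    obtain ⟨T, hT, hTm⟩ := isTerm_lambdas hπ
    obtain ⟨T', hT', hTm'⟩ := isTerm_lambdas hπ'
    refine ⟨π, T, π', T', hT, hT', fun h => ?_⟩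
    have e1 : Finset.univ.filter (fun r => BlockLambda B k f r (π r)) = Tᶜ := by
      ext r
      simp [hTm]
    have e2 : Finset.univ.filter (fun r => BlockLambda B k f r (π' r)) = T'ᶜ := by
      ext r
      simp [hTm']
    rw [h1, h2, e1, e2, Finset.card_compl, Finset.card_compl, h] at hγ
    exact lt_irrefl _ hγ
  · obtain ⟨h1, h2, h3⟩ := BipartiteGraph.mem_edges_induce.1 he
    obtain ⟨s, rfl⟩ := hB.exists_right k c h3
    have hr : B r = k := (hB.mem_left _ _).1 h2
    have hs : B s = k := (hB.mem_right _ _).1 h3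
    obtain ⟨π, hπ, hE⟩ := block_isEntry_admissible hB hD hj ⟨r, hr⟩ ⟨s, hs⟩
      ((isEntry_block_iff B k hj).2 h1)
    obtain ⟨T, hT, hTm⟩ := isTerm_parameters hE
    have hrT : ⟨r, hr⟩ ∈ T := by
      obtain ⟨t, ht⟩ := exists_squareParameter_iff.2 hstar
      exact hTm _ t (by rw [hπ]; exact ht)
    -- At the self-loop either the parameter or λ can be chosen on the same permutation, which
    -- changes the degree in λ by one.
    refine ⟨π, T, π, T.erase ⟨r, hr⟩, hT, ⟨fun r' hr' => hT.1 r' (Finset.mem_of_mem_erase hr'),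
      fun r' hr' => ?_⟩, (Finset.card_erase_lt_of_mem hrT).ne'⟩
    by_cases h : r' = ⟨r, hr⟩
    · rw [lambdaEntries_ne_zero, h, hπ]
      exact hl
    · exact hT.2 r' fun h' => hr' (Finset.mem_erase.2 ⟨h, h'⟩)

/-- In a block with `γ_nz = 0` all terms of the determinant have the same degree in `λ`. -/
theorem card_eq_of_not_gammaNonzero (hB : (pencilGraphDelete H j).IsBlockMatching Vp Vm f B)
    (hj : ∀ s, f s ≠ j) (i : Fin n)
    (hγ : ¬ GammaNonzero H ((pencilGraphDelete H j).induce (Vp k) (Vm k)))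
    (π : Equiv.Perm {r // B r = k}) (T : Finset {r // B r = k})
    (π' : Equiv.Perm {r // B r = k}) (T' : Finset {r // B r = k})
    (hT : IsTerm (blockParameter B k H f) (lambdaEntries (BlockLambda B k f)) π T)
    (hT' : IsTerm (blockParameter B k H f) (lambdaEntries (BlockLambda B k f)) π' T') :
    T.card = T'.card := by
  classical
  rw [GammaNonzero, not_or, not_lt] at hγ
  obtain ⟨hγ, hloop⟩ := hγ
  -- Without self-loops no position offers a choice, so the degree in λ of a term is the number of
  -- λ-edges of its matching, which is constant.
  have key : ∀ {π : Equiv.Perm {r // B r = k}} {T : Finset {r // B r = k}},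
      IsTerm (blockParameter B k H f) (lambdaEntries (BlockLambda B k f)) π T →
        Tᶜ.card = gammaMax ((pencilGraphDelete H j).induce (Vp k) (Vm k)) := by
    intro π T hT
    have hE : ∀ r, IsEntry (blockParameter B k H f) (BlockLambda B k f) r (π r) := by
      intro r
      by_cases hr : r ∈ T
      · exact Or.inl (hT.1 r hr)
      · exact Or.inr (lambdaEntries_ne_zero.1 (hT.2 r hr))
    have hTm : Tᶜ = Finset.univ.filter fun r => BlockLambda B k f r (π r) := by
      ext r
      rw [Finset.mem_compl, Finset.mem_filter]
      refine ⟨fun h => ⟨Finset.mem_univ _, lambdaEntries_ne_zero.1 (hT.2 r h)⟩, fun h hr => ?_⟩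
      apply hloop
      refine ⟨(r.1, f (π r)), BipartiteGraph.mem_edges_induce.2
        ⟨(isEntry_block_iff B k hj).1 (hE r), (hB.mem_left _ _).2 r.2,
          (hB.mem_right _ _).2 (π r).2⟩, h.2, ?_⟩
      exact exists_squareParameter_iff.1 (hT.1 r hr)
    have := lambda_count_bounds hB hj i hE
    rw [hTm]
    omega
  have h1 := key hT
  have h2 := key hT'
  rw [Finset.card_compl] at h1 h2
  have := Finset.card_le_univ T
  have := Finset.card_le_univ T'
  omega

end Square

/-! ### Uncontrollable modes after the perturbation of one entry -/

section Mode

variable {n : ℕ}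

theorem augment_sub_smul_one (A : Matrix (Fin n) (Fin n) ℂ) (b : Fin n → ℂ) (z : ℂ) (r : Fin n)
    (c : Fin (n + 1)) : augment (A - z • (1 : Matrix (Fin n) (Fin n) ℂ)) b r c
      = augment A b r c - if c = r.castSucc then z else 0 := by
  induction c using Fin.lastCases with
  | last => simp [augment, (Fin.castSucc_lt_last r).ne']
  | cast c =>
    simp only [augment, Fin.snoc_castSucc, Matrix.sub_apply, Matrix.smul_apply, Matrix.one_apply,
      smul_eq_mul, mul_ite, mul_one, mul_zero, Fin.castSucc_inj]
    simp only [eq_comm]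

theorem augment_add (A ΔA : Matrix (Fin n) (Fin n) ℂ) (b Δb : Fin n → ℂ) (r : Fin n)
    (c : Fin (n + 1)) : augment (A + ΔA) (b + Δb) r c = augment A b r c + augment ΔA Δb r c := by
  induction c using Fin.lastCases with
  | last => simp [augment]
  | cast c => simp [augment]

theorem augment_perturbed_pencil (A ΔA : Matrix (Fin n) (Fin n) ℂ) (b Δb : Fin n → ℂ) (z : ℂ)
    (r : Fin n) (c : Fin (n + 1)) :
    augment (A + ΔA - z • (1 : Matrix (Fin n) (Fin n) ℂ)) (b + Δb) r c
      = (augment A b r c - if c = r.castSucc then z else 0) + augment ΔA Δb r c := by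
  rw [augment_sub_smul_one, augment_add]
  ring

/-- The pencil `[A - z I, b]` of a controllable pair has trivial left kernel. -/
theorem IsControllable.eq_zero_of_pencil {A : Matrix (Fin n) (Fin n) ℂ} {b : Fin n → ℂ}
    (h : IsControllable A b) {z : ℂ} {q : Fin n → ℂ}
    (hq : ∀ c, ∑ r, q r * (augment A b r c - if c = r.castSucc then z else 0) = 0) : q = 0 := by
  apply h.eq_zero_of_eigenvector (z := z)
  · funext c
    have h1 := hq c.castSucc
    simp only [augment, Fin.snoc_castSucc, Fin.castSucc_inj, mul_sub, Finset.sum_sub_distrib,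
      mul_ite, mul_zero, Finset.sum_ite_eq, Finset.mem_univ, if_true] at h1
    rw [sub_eq_zero] at h1
    rw [Pi.smul_apply, smul_eq_mul, mul_comm, ← h1]
    rfl
  · have h1 := hq (Fin.last n)
    simp only [augment, Fin.snoc_last, (Fin.castSucc_lt_last _).ne', if_false, sub_zero] at h1
    exact h1

/-- Changing the entry at `(i, j)` creates the mode `z` iff the pencil without the column `j` has
a left null vector whose entry at `i` does not vanish. -/
theorem canCreateNonzeroMode_iff {A : Matrix (Fin n) (Fin n) ℂ} {b : Fin n → ℂ}
    (h : IsControllable A b) {F : StructuredMatrix (Fin n) (Fin (n + 1))} {i : Fin n}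
    {j : Fin (n + 1)} (hF : ∀ r c, F r c = true ↔ r = i ∧ c = j) :
    CanCreateNonzeroMode F A b ↔ ∃ z : ℂ, z ≠ 0 ∧ ∃ q : Fin n → ℂ, q i ≠ 0 ∧
      ∀ c, c ≠ j → ∑ r, q r * (augment A b r c - if c = r.castSucc then z else 0) = 0 := by
  constructor
  · rintro ⟨ΔA, Δb, hΔ, z, q, hz, hq, hmode⟩
    have hΔ0 : ∀ r c, ¬ (r = i ∧ c = j) → augment ΔA Δb r c = 0 := fun r c hrc =>
      hΔ r c (by
        rw [← hF] at hrc
        simpa using hrc)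
    have hsum : ∀ c, ∑ r, q r * (augment A b r c - if c = r.castSucc then z else 0)
        + q i * augment ΔA Δb i c = 0 := by
      intro c
      have h1 := congrFun hmode c
      have h2 : ∑ r, q r * augment (A + ΔA - z • (1 : Matrix (Fin n) (Fin n) ℂ)) (b + Δb) r c = 0 :=
        h1
      simp only [augment_perturbed_pencil, mul_add, Finset.sum_add_distrib] at h2
      rwa [Finset.sum_eq_single i (f := fun r => q r * augment ΔA Δb r c)
        (fun r _ hr => by rw [hΔ0 r c fun h' => hr h'.1, mul_zero])
        (fun h' => absurd (Finset.mem_univ _) h')] at h2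
    -- If `q i = 0`, the perturbation is invisible to `q`, and `q` would be a left null vector of
    -- the controllable pencil.
    refine ⟨z, hz, q, fun hqi => ?_, fun c hc => ?_⟩
    · apply hq
      apply h.eq_zero_of_pencil (z := z)
      intro c
      have := hsum c
      rwa [hqi, zero_mul, add_zero] at this
    · have := hsum c
      rwa [hΔ0 i c fun h' => hc h'.2, mul_zero, add_zero] at this
  · rintro ⟨z, hz, q, hqi, hker⟩
    -- The perturbation contributes `q i * δ` to column `j` only; `δ` is chosen to cancel that
    -- column.
    set δ := -(∑ r, q r * (augment A b r j - if j = r.castSucc then z else 0)) / q i with hδ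
    obtain ⟨ΔA, Δb, haug⟩ : ∃ (ΔA : Matrix (Fin n) (Fin n) ℂ) (Δb : Fin n → ℂ),
        ∀ r c, augment ΔA Δb r c = if r = i ∧ c = j then δ else 0 := by
      refine ⟨fun r c => if r = i ∧ Fin.castSucc c = j then δ else 0,
        fun r => if r = i ∧ Fin.last n = j then δ else 0, fun r c => ?_⟩
      induction c using Fin.lastCases with
      | last => simp [augment]
      | cast c => simp [augment]
    refine ⟨ΔA, Δb, fun r c hrc => ?_, z, q, hz, ?_, ?_⟩
    · rw [haug, if_neg]
      rw [← hF]
      simp [hrc]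
    · rintro rfl
      exact hqi rfl
    · funext c
      change ∑ r, q r * augment (A + ΔA - z • (1 : Matrix (Fin n) (Fin n) ℂ)) (b + Δb) r c = 0
      simp only [augment_perturbed_pencil, haug, mul_add, Finset.sum_add_distrib]
      by_cases hc : c = j
      · subst hc
        simp only [and_true, mul_ite, mul_zero, Finset.sum_ite_eq', Finset.mem_univ, if_true]
        rw [hδ]
        field_simp
        simp
      · rw [hker c hc]
        simp [hc]

/-- If the left kernel of a square matrix is spanned by a vector with nonzero entry at `i`, then
replacing the row `i` by the unit vector at a nonzero entry of a right null vector gives a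
nonsingular matrix. -/
theorem det_updateRow_ne_zero {N : Matrix (Fin n) (Fin n) ℂ} {i s : Fin n}
    (hker : ∀ v, Matrix.vecMul v N = 0 → v i = 0 → v = 0) {u : Fin n → ℂ} (hu : N.mulVec u = 0)
    (hus : u s ≠ 0) : (N.updateRow i (Pi.single s 1)).det ≠ 0 := by
  intro hdet
  obtain ⟨v, hv, hvN⟩ := Matrix.exists_vecMul_eq_zero_iff.2 hdet
  -- Pairing this with a left null vector `v` of the modified matrix gives `v i * u s = 0`. Then `v
  -- i = 0`, so `v` is also a left null vector of `N`, and `hker` applies.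
  have hmul : (N.updateRow i (Pi.single s 1)).mulVec u = Pi.single i (u s) := by
    funext r
    by_cases hr : r = i
    · subst hr
      simp [Matrix.mulVec]
    · have := congrFun hu r
      simp only [Matrix.mulVec, Matrix.updateRow_ne hr, Pi.single_eq_of_ne hr]
      exact this
  have hvi : v i = 0 := by
    have h1 := Matrix.dotProduct_mulVec v (N.updateRow i (Pi.single s 1)) u
    rw [hvN, hmul, zero_dotProduct, dotProduct_single] at h1
    exact (mul_eq_zero.1 h1).resolve_right hus
  apply hv
  apply hker v _ hvi
  funext c
  have h1 := congrFun hvN c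
  simp only [Matrix.vecMul, dotProduct, Pi.zero_apply] at h1 ⊢
  rw [← h1]
  refine Finset.sum_congr rfl fun r _ => ?_
  by_cases hr : r = i
  · rw [hr, hvi, zero_mul, zero_mul]
  · rw [Matrix.updateRow_ne hr]

/-- A null vector of a block triangular matrix restricts to a null vector of the last block on
which it does not vanish. -/
theorem exists_block_det_eq_zero {κ : Type} [LinearOrder κ] {N : Matrix (Fin n) (Fin n) ℂ}
    {B : Fin n → κ} (hN : N.BlockTriangular B) {u : Fin n → ℂ} (hu0 : u ≠ 0)
    (hu : N.mulVec u = 0) : ∃ s, u s ≠ 0 ∧ (N.toSquareBlock B (B s)).det = 0 := by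
  obtain ⟨s₀, hs₀⟩ := Function.ne_iff.1 hu0
  -- In the rows of the last block meeting the support of `u`, entries of earlier blocks vanish by
  -- triangularity and later coordinates of `u` are zero.
  obtain ⟨s, hs, hmax⟩ := Finset.exists_max_image (Finset.univ.filter fun s => u s ≠ 0) B
    ⟨s₀, by simpa using hs₀⟩
  have hs : u s ≠ 0 := by simpa using hs
  refine ⟨s, hs, ?_⟩
  rw [← Matrix.exists_mulVec_eq_zero_iff]
  refine ⟨fun x => u x, fun h0 => hs (congrFun h0 ⟨s, rfl⟩), ?_⟩
  funext r
  have h1 := congrFun hu r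
  simp only [Matrix.mulVec, dotProduct, Pi.zero_apply] at h1 ⊢
  rw [← h1]
  have h2 : ∑ x, N r x * u x = ∑ x ∈ Finset.univ.filter (fun x => B x = B s), N r x * u x := by
    symm
    apply Finset.sum_subset (Finset.subset_univ _)
    intro x _ hx
    have hx : B x ≠ B s := by simpa using hx
    rcases lt_or_gt_of_ne hx with h3 | h3
    · rw [hN (by rw [r.2]; exact h3), zero_mul]
    · by_cases hux : u x = 0
      · rw [hux, mul_zero]
      · exact absurd (hmax x (by simpa using hux)) (not_le.2 h3)
  rw [h2, Finset.sum_subtype (p := fun x => B x = B s) _ (by simp)]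
  rfl

end Mode

theorem pencilValue_square_blockTriangular {n d : ℕ} {H : StructuredMatrix (Fin n) (Fin (n + 1))}
    {f : Fin n → Fin (n + 1)} {Vp : Fin (d + 2) → Finset (Fin n)}
    {Vm : Fin (d + 2) → Finset (Fin (n + 1))} {B : Fin n → Fin (d + 2)} {j : Fin (n + 1)}
    (hB : (pencilGraphDelete H j).IsBlockMatching Vp Vm f B) (hj : ∀ s, f s ≠ j)
    (θ : ParameterSpace H) (z : ℂ) :
    (pencilValue (squareParameter H f) (SquareLambda f) θ z).BlockTriangular B := by
  intro r s hrs
  by_contra hne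
  apply absurd (hB.triangular r s ?_) (not_le.2 hrs)
  rw [← isEntry_square_iff (H := H) hj]
  by_contra hE
  rw [IsEntry, not_or, exists_squareParameter_iff] at hE
  apply hne
  rw [pencilValue_square_apply, if_neg (show ¬ f s = r.castSucc from hE.2), sub_zero]
  exact dif_neg hE.1

end

/-! ### The equivalence for generic controllable pairs -/

theorem proposition4 {n : ℕ} (A' : StructuredMatrix (Fin n) (Fin n)) (b' : Fin n → Bool)
    (hsc : StructurallyControllable A' b')
    (F : StructuredMatrix (Fin n) (Fin (n + 1))) (i : Fin n) (j : Fin (n + 1))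
    (hF : ∀ r c, F r c = true ↔ r = i ∧ c = j)
    (d : ℕ) (Vp : Fin (d + 2) → Finset (Fin n)) (Vm : Fin (d + 2) → Finset (Fin (n + 1)))
    (hDM : (pencilGraphDelete (augment A' b') j).IsDMDecomposition d Vp Vm)
    (s : Fin (d + 2)) (hs : i ∈ Vp s) :
    ForAlmostAllControllable A' b' fun A b =>
      (CanCreateNonzeroMode F A b ↔
        ∃ k ∈ omegaSet (augment A' b') j Vp Vm s,
          (intervalGraph (augment A' b') j Vp Vm k s i).minWeightMaximumMatching
            (componentWeight (augment A' b') j Vp Vm k) < (Vp k).card) := by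
  classical
  obtain ⟨f, hf, hfE⟩ := exists_perfect_matching hsc j
  set H := augment A' b' with hH
  have hj : ∀ r, f r ≠ j := fun r => (mem_edges_pencilGraphDelete.1 (hfE r)).2
  have hright : ∀ c ∈ (pencilGraphDelete H j).right, ∃ r, f r = c := fun c hc =>
    exists_eq_of_ne hf hj (by simpa [pencilGraphDelete, BipartiteGraph.induce, pencilGraph] using hc)
  obtain ⟨B, hB⟩ := hDM.1.exists_isBlockMatching
    (by simp [pencilGraphDelete, BipartiteGraph.induce, pencilGraph]) hf hright hfE
  obtain rfl : B i = s := (hB.mem_left i s).1 hs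
  have hindep := independentEntries_squareParameter (H := H) hf
  have hrowf := rowFunctional_squareLambda hf
  -- One exceptional polynomial for each column `c` rather than for each block, since the minor to
  -- be avoided depends on `c`. There are finitely many, so almost every `θ` avoids all their zeros.
  have hgood : ∀ c : Fin n, ∃ ρ : MvPolynomial {e : Fin n × Fin (n + 1) // H e.1 e.2 = true} ℂ,
      ρ ≠ 0 ∧ ∀ θ, MvPolynomial.eval θ ρ ≠ 0 →
        (GammaNonzero H ((pencilGraphDelete H j).induce (Vp (B c)) (Vm (B c))) →
          (∃ π : Equiv.Perm (Fin n), π i = c ∧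
            ∀ r, r ≠ i → (r, f (π r)) ∈ (pencilGraphDelete H j).edges) →
          ∃ z : ℂ, z ≠ 0 ∧ ((pencilValue (squareParameter H f) (SquareLambda f) θ z).toSquareBlock
              B (B c)).det = 0 ∧
            ((pencilValue (squareParameter H f) (SquareLambda f) θ z).updateRow i
              (Pi.single c 1)).det ≠ 0) ∧
        (¬ GammaNonzero H ((pencilGraphDelete H j).induce (Vp (B c)) (Vm (B c))) →
          ∀ z : ℂ, ((pencilValue (squareParameter H f) (SquareLambda f) θ z).toSquareBlock
            B (B c)).det = 0 → z = 0) := by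
    intro c
    have he := independentEntries_blockParameter (H := H) B (B c) hf
    have hL := rowFunctional_blockLambda B (B c) hf
    have hdiag : ∀ r, IsEntry (blockParameter B (B c) H f) (BlockLambda B (B c) f) r r :=
      fun r => (isEntry_block_iff B (B c) hj).2 (hfE r)
    by_cases hγ : GammaNonzero H ((pencilGraphDelete H j).induce (Vp (B c)) (Vm (B c)))
    · by_cases hπ : ∃ π : Equiv.Perm (Fin n), π i = c ∧
          ∀ r, r ≠ i → (r, f (π r)) ∈ (pencilGraphDelete H j).edges
      · obtain ⟨π₀, hπ₀, hE₀⟩ := hπ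
        have ha := pencilMinor_ne_zero hindep hrowf hπ₀
          fun r hr => (isEntry_square_iff hj).2 (hE₀ r hr)
        obtain ⟨π, T, π', T', hT, hT', hne⟩ := exists_terms_of_gammaNonzero hB hDM.1 hj i hγ
        obtain ⟨ρ, hρ, hroot⟩ := exists_generic_nonzero_root he hL
          (fun r r' s h h' => Subtype.ext (squareLambda_left_unique h h'))
          (fun r s h => block_isEntry_admissible hB hDM.1 hj r s h) hdiag
          (fun S hS hcl r => by
            have := hB.eq_block_of_closed hDM (k := B c) (S := Subtype.val '' S)
              (by
                rintro _ ⟨x, -, rfl⟩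
                exact x.2) (hS.image _) (by
                intro x y hx hy hxy
                have := hcl ⟨x, hx⟩ ⟨y, hy⟩ ((isEntry_block_iff B (B c) hj).2 hxy)
                simpa [hx, hy] using this) r r.2
            obtain ⟨x, hx, hxr⟩ := this
            rwa [← Subtype.ext hxr]) hT hT' hne ha ⟨c, rfl⟩
          (fun r t h => notMem_vars_pencilMinor hindep h)
        refine ⟨ρ, hρ, fun θ hθ => ⟨fun _ _ => ?_, fun h => absurd hγ h⟩⟩
        obtain ⟨z, hz, h1, h2⟩ := hroot θ hθ
        rw [eval_det_block] at h1
        rw [eval_pencilMinor] at h2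
        exact ⟨z, hz, h1, h2⟩
      · exact ⟨1, one_ne_zero, fun θ _ => ⟨fun _ h => absurd h hπ, fun h => absurd hγ h⟩⟩
    · obtain ⟨ρ, hρ, hroot⟩ := exists_generic_no_root he hL hdiag
        (card_eq_of_not_gammaNonzero hB hj i hγ)
      refine ⟨ρ, hρ, fun θ hθ => ⟨fun h => absurd h hγ, fun _ z hz => hroot θ hθ z ?_⟩⟩
      rw [eval_det_block]
      exact hz
  choose ρ hρ hρθ using hgood
  have hae : ∀ᵐ θ : ParameterSpace H, ∀ c, MvPolynomial.eval θ (ρ c) ≠ 0 :=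
    ae_all_iff.2 fun c => ae_eval_ne_zero (ρ c) (hρ c)
  filter_upwards [hae] with θ hθ A b hAb hctrl
  have hval : ∀ z r c, pencilValue (squareParameter H f) (SquareLambda f) θ z r c
      = augment A b r (f c) - if f c = r.castSucc then z else 0 := by
    intro z r c
    rw [pencilValue_square_apply, hAb]
  have hvecMul : ∀ (z : ℂ) (q : Fin n → ℂ),
      Matrix.vecMul q (pencilValue (squareParameter H f) (SquareLambda f) θ z) = 0 ↔
        ∀ c, c ≠ j → ∑ r, q r * (augment A b r c - if c = r.castSucc then z else 0) = 0 := by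
    intro z q
    rw [funext_iff]
    simp only [Matrix.vecMul, dotProduct, hval, Pi.zero_apply]
    constructor
    · intro h c hc
      obtain ⟨x, rfl⟩ := exists_eq_of_ne hf hj hc
      exact h x
    · intro h x
      exact h (f x) (hj x)
  have hcond : ∀ k, k ≤ B i → ((intervalGraph H j Vp Vm k (B i) i).minWeightMaximumMatching
      (componentWeight H j Vp Vm k) < (Vp k).card ↔ ∃ π : Equiv.Perm (Fin n), B (π i) = k ∧
        ∀ r, r ≠ i → (r, f (π r)) ∈ (pencilGraphDelete H j).edges) := by
    intro k hk
    convert hB.minWeight_interval_lt_iff hk using 2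
    rfl
  rw [canCreateNonzeroMode_iff hctrl hF]
  constructor
  · rintro ⟨z, hz, q, hqi, hq⟩
    rw [← hvecMul] at hq
    set N := pencilValue (squareParameter H f) (SquareLambda f) θ z with hN
    have hq0 : q ≠ 0 := by
      rintro rfl
      exact hqi rfl
    -- The left kernel is a line: with `α` and `β` the products of `v` and `q` with column `j`, the
    -- combination `α q - β v` annihilates the full pencil and so vanishes. Its entry at `i` gives
    -- `α = 0`, and then `v` itself annihilates the full pencil.
    have hker : ∀ v, Matrix.vecMul v N = 0 → v i = 0 → v = 0 := by
      intro v hv hvi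
      have hv' := (hvecMul z v).1 hv
      have hq' := (hvecMul z q).1 hq
      set α := ∑ r, v r * (augment A b r j - if j = r.castSucc then z else 0) with hα
      set β := ∑ r, q r * (augment A b r j - if j = r.castSucc then z else 0) with hβ
      have hw : (fun r => α * q r - β * v r) = 0 := by
        apply hctrl.eq_zero_of_pencil (z := z)
        intro c
        have hlin : ∑ r, (α * q r - β * v r) * (augment A b r c - if c = r.castSucc then z else 0)
            = α * ∑ r, q r * (augment A b r c - if c = r.castSucc then z else 0)
              - β * ∑ r, v r * (augment A b r c - if c = r.castSucc then z else 0) := by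
          rw [Finset.mul_sum, Finset.mul_sum, ← Finset.sum_sub_distrib]
          exact Finset.sum_congr rfl fun r _ => by ring
        rw [hlin]
        by_cases hc : c = j
        · rw [hc, ← hα, ← hβ]
          ring
        · rw [hq' c hc, hv' c hc]
          ring
      have hα0 : α = 0 := by
        have := congrFun hw i
        simp only [hvi, mul_zero, sub_zero, Pi.zero_apply] at this
        exact (mul_eq_zero.1 this).resolve_right hqi
      apply hctrl.eq_zero_of_pencil (z := z)
      intro c
      by_cases hc : c = j
      · rw [hc, ← hα, hα0]
      · exact hv' c hc
    obtain ⟨u, hu0, hu⟩ := Matrix.exists_mulVec_eq_zero_iff.2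
      (Matrix.exists_vecMul_eq_zero_iff.1 ⟨q, hq0, hq⟩)
    obtain ⟨c, huc, hdet⟩ :=
      exists_block_det_eq_zero (pencilValue_square_blockTriangular hB hj θ z) hu0 hu
    have hγ : GammaNonzero H ((pencilGraphDelete H j).induce (Vp (B c)) (Vm (B c))) := by
      by_contra hγ
      exact hz ((hρθ c θ (hθ c)).2 hγ z hdet)
    obtain ⟨π, hπ, hE⟩ := exists_perm_of_pencilMinor_ne_zero (det_updateRow_ne_zero hker hu huc)
    have hE' : ∀ r, r ≠ i → (r, f (π r)) ∈ (pencilGraphDelete H j).edges :=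
      fun r hr => (isEntry_square_iff hj).1 (hE r hr)
    have hle : B c ≤ B i := hπ ▸ hB.block_le_of_perm hE'
    exact ⟨B c, ⟨hB.ne_zero c, hB.ne_last c, hle, hγ⟩, (hcond _ hle).2 ⟨π, by rw [hπ], hE'⟩⟩
  · rintro ⟨k, ⟨-, -, hle, hγ⟩, hlt⟩
    obtain ⟨π, hπk, hE⟩ := (hcond k hle).1 hlt
    subst hπk
    obtain ⟨z, hz, hdet, hminor⟩ := (hρθ (π i) θ (hθ (π i))).1 hγ ⟨π, rfl, hE⟩
    set N := pencilValue (squareParameter H f) (SquareLambda f) θ z with hN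
    have hdetN : N.det = 0 := by
      rw [(pencilValue_square_blockTriangular hB hj θ z).det]
      exact Finset.prod_eq_zero (Finset.mem_image_of_mem B (Finset.mem_univ (π i))) hdet
    -- As `N` is singular, `N.adjugate * N = 0`, so each row of the adjugate is a left null vector;
    -- the entry at `i` of the row `π i` is the nonvanishing minor.
    refine ⟨z, hz, N.adjugate (π i), ?_, ?_⟩
    · rwa [Matrix.adjugate_apply]
    · rw [← hvecMul]
      funext c
      have := congrFun (congrFun N.adjugate_mul (π i)) c
      rw [hdetN, zero_smul] at this
      exact this
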